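/- Fix $\varepsilon\in(0,2)$. Let $A_+$ be the operator on the complex Hilbert space $\ell^2(\mathbf{Z}_+)$, $\mathbf{Z}_+=\{1,2,3,\dots\}$, defined by \[(A_+v)_n=\frac{\varepsilon}{2}n(n-1)v_{n-1}-\frac{\varepsilon}{2}n(n+1)v_{n+1}+nv_n\qquad(n\ge 1)\] (the first term being absent for $n=1$) on its maximal domain $\{v\in\ell^2(\mathbf{Z}_+) : A_+v\in\ell^2(\mathbf{Z}_+)\}$. For $0<x<1$ let \[p(x)=(1-x)^{1+1/\varepsilon}(x+1)^{1-1/\varepsilon},\qquad w(x)=x^{-1}(1-x)^{1/\varepsilon}(x+1)^{-1/\varepsilon}.\] Call $\mu\in\mathbf{C}$ an eigenvalue of the singular Sturm--Liouville problem $-(pu')'=\mu wu$ if there is a complex-valued function $u\in C^\infty([0,1])$, not identically zero, with $u(0)=0$, which satisfies $-(pu')'(x)=\mu w(x)u(x)$ for all $x\in(0,1)$. Then, if $\mu\in\mathbf{C}$ is an eigenvalue of the Sturm--Liouville problem, $\lambda=\varepsilon\mu/2$ is an eigenvalue of $A_+$. Moreover, for every $\lambda\in\mathbf{C}$, $\lambda$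 is an eigenvalue of $A_+$ if and only if $\mu=2\lambda/\varepsilon$ is an eigenvalue of the Sturm--Liouville problem. -/

import Mathlib

open scoped ContDiff ENNReal

/-- The Hilbert space `ℓ²(ℤ₊)` of complex square-summable sequences `(vₙ)` with `n = 1, 2, 3, …`. -/
abbrev EllTwo : Type := lp (fun _ : ℕ+ => ℂ) 2

/-- The formal tridiagonal action
`(𝒜v)ₙ = (ε/2) n (n-1) vₙ₋₁ - (ε/2) n (n+1) vₙ₊₁ + n vₙ` on all sequences indexed by `n ≥ 1`.
For `n = 1` the index `n - 1` is read as `1` by the subtraction of `ℕ+`, but the coefficient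
`n (n-1)` is then zero, so the term is absent, as it should be. -/
noncomputable def formalAPlus (ε : ℝ) : (ℕ+ → ℂ) →ₗ[ℂ] (ℕ+ → ℂ) where
  toFun v n := (ε : ℂ) / 2 * ((n : ℂ) * ((n : ℂ) - 1)) * v (n - 1)
    - (ε : ℂ) / 2 * ((n : ℂ) * ((n : ℂ) + 1)) * v (n + 1) + (n : ℂ) * v n
  map_add' v w := by
    funext n
    simp only [Pi.add_apply]
    ring
  map_smul' c v := by
    funext n
    simp only [Pi.smul_apply, smul_eq_mul, RingHom.id_apply]
    ring

/-- The operator `A₊` on `ℓ²(ℤ₊)`, with its natural maximal domain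
`{v ∈ ℓ² : 𝒜v ∈ ℓ²}`, as an unbounded operator. -/
noncomputable def APlus (ε : ℝ) : EllTwo →ₗ.[ℂ] EllTwo where
  domain :=
    { carrier := {v | Memℓp (formalAPlus ε (v : ℕ+ → ℂ)) 2}
      zero_mem' := by
        simp only [Set.mem_ofPred_eq, lp.coeFn_zero, map_zero]
        exact zero_memℓp
      add_mem' := by
        intro v w hv hw
        simp only [Set.mem_ofPred_eq, lp.coeFn_add, map_add] at hv hw ⊢
        exact Memℓp.add hv hw
      smul_mem' := by
        intro c v hv
        simp only [Set.mem_ofPred_eq, lp.coeFn_smul, map_smul] at hv ⊢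
        exact Memℓp.const_smul hv c }
  toFun :=
    { toFun := fun v => ⟨formalAPlus ε ((v : EllTwo) : ℕ+ → ℂ), v.2⟩
      map_add' := fun v w => Subtype.ext
        ((formalAPlus ε).map_add ((v : EllTwo) : ℕ+ → ℂ) ((w : EllTwo) : ℕ+ → ℂ))
      map_smul' := fun c v => Subtype.ext
        ((formalAPlus ε).map_smul c ((v : EllTwo) : ℕ+ → ℂ)) }

/-- `z` is an eigenvalue of the unbounded operator `T`: there is a non-zero vector `v` in the
domain of `T` with `T v = z v`. -/
def IsEigenvalue {E : Type*} [AddCommGroup E] [Module ℂ E] (T : E →ₗ.[ℂ] E) (z : ℂ) : Prop :=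
  ∃ v : T.domain, (v : E) ≠ 0 ∧ T v = z • (v : E)

/-- The coefficient `p(x) = (1-x)^{1+1/ε} (x+1)^{1-1/ε}`. -/
noncomputable def slP (ε x : ℝ) : ℝ := (1 - x) ^ (1 + 1 / ε) * (x + 1) ^ (1 - 1 / ε)

/-- The weight `w(x) = x⁻¹ (1-x)^{1/ε} (x+1)^{-1/ε}`. -/
noncomputable def slW (ε x : ℝ) : ℝ := x⁻¹ * (1 - x) ^ (1 / ε) * (x + 1) ^ (-(1 / ε))

/-- `m` is an eigenvalue of the singular Sturm–Liouville problem `-(p u')' = m w u` on `(0,1)`: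
there is a function `u ∈ C^∞([0,1])`, complex-valued and not identically zero on `[0,1]`, with
`u(0) = 0`, that satisfies the equation at every point of `(0,1)`. -/
def IsSLEigenvalue (ε : ℝ) (m : ℂ) : Prop :=
  ∃ u : ℝ → ℂ, ContDiffOn ℝ ∞ u (Set.Icc 0 1) ∧ u 0 = 0 ∧ (∃ x ∈ Set.Icc (0 : ℝ) 1, u x ≠ 0) ∧
    ∀ x ∈ Set.Ioo (0 : ℝ) 1,
      -deriv (fun y : ℝ => (slP ε y : ℂ) * deriv u y) x = m * (slW ε x : ℂ) * u x

/-! The generating function `u(x) = ∑ vₙ xⁿ` turns `A₊ v = λ v` into `x(1-x²)u'' - 2x(x+1/ε)u' + μu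
= 0` with `μ = 2λ/ε`, which is the Sturm–Liouville equation divided by `w`, up to sign. The question
is which behaviour at the singular point `1` (exponents `0` and `-1/ε`) matches square-summability.

From `ℓ²` to smooth: Cauchy–Schwarz gives `u, u' = O((1-x)^(-3/2))`, while `p` is of order
`(1-x)^(1+1/ε)`. Since `1/ε > 1/2`, both `pu` and `pu'` tend to `0` at `1`. Hence the constant
`p`-weighted Wronskian of `u` with the analytic solution at `1` is zero, and `u` continues smoothly
through `1` (`exists_eq_mul_frobenius`, `isSLEigenvalue_of_summable_sq`).

From smooth to `ℓ²`: symmetry makes `μ` real (`im_eq_zero_of_solvesAt`), and uniqueness at `0` makes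
the eigenfunction a nonzero multiple of the series `f = ∑ aₙ xⁿ` given by the recurrence
(`eq_zero_of_solvesAt`). So `f'` is bounded on `(0,1)`. Its coefficients `bₙ = n aₙ` satisfy `bₙ₊₂ =
bₙ + κₙ bₙ₊₁` with `κₙ ≥ 0` eventually. Either `b` is bounded and `aₙ = O(1/n)` lies in `ℓ²`, or `b`
eventually has one sign and stays away from `0`, which would make `f'` unbounded
(`bounded_or_eventually_ge`, `not_bounded_pser_of_eventually_ge`). -/

/-! ### Power series of a real variable with complex coefficients. -/

/-- The sum of the power series with coefficients `a` at the real point `x`. -/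
noncomputable def pser (a : ℕ → ℂ) (x : ℝ) : ℂ := ∑' n, a n * (x : ℂ) ^ n

/-- The coefficients `a` grow slowly enough for the power series to converge on `(-R, R)`. -/
def ConvOn (R : ℝ) (a : ℕ → ℂ) : Prop :=
  ∀ r, 0 < r → r < R → ∃ C, ∀ n, ‖a n‖ * r ^ n ≤ C

/-- Coefficients of the formal derivative. -/
def dcoeff (a : ℕ → ℂ) (n : ℕ) : ℂ := ((n : ℂ) + 1) * a (n + 1)

/-- Coefficients of the power series multiplied by the variable. -/
def xcoeff (a : ℕ → ℂ) : ℕ → ℂ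
  | 0 => 0
  | n + 1 => a n

theorem ConvOn.summable_norm {R : ℝ} {a : ℕ → ℂ} (ha : ConvOn R a) {r : ℝ} (h0 : 0 ≤ r)
    (hr : r < R) : Summable fun n => ‖a n‖ * r ^ n := by
  obtain ⟨t, h1, h2⟩ := exists_between hr
  have ht : 0 < t := h0.trans_lt h1
  obtain ⟨C, hC⟩ := ha t ht h2
  have hs : Summable fun n : ℕ => C * (r / t) ^ n :=
    (summable_geometric_of_lt_one (by positivity) ((div_lt_one ht).2 h1)).mul_left C
  refine hs.of_nonneg_of_le (fun n => by positivity) fun n => ?_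
  calc ‖a n‖ * r ^ n = (‖a n‖ * t ^ n) * (r / t) ^ n := by
        rw [div_pow]; field_simp
    _ ≤ C * (r / t) ^ n := by gcongr; exact hC n

theorem ConvOn.summable {R : ℝ} {a : ℕ → ℂ} (ha : ConvOn R a) {x : ℝ} (hx : |x| < R) :
    Summable fun n => a n * (x : ℂ) ^ n := by
  refine Summable.of_norm ?_
  simpa using ha.summable_norm (abs_nonneg x) hx

/-- Passing to a slightly larger radius `t < R` absorbs the factor `n + 1`, because `n (r/t)^n` is
bounded. -/
theorem ConvOn.dcoeff {R : ℝ} {a : ℕ → ℂ} (ha : ConvOn R a) : ConvOn R (dcoeff a) := by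
  intro r h0 hr
  obtain ⟨t, h1, h2⟩ := exists_between hr
  have ht : 0 < t := h0.trans h1
  obtain ⟨C, hC⟩ := ha t ht h2
  have hq : r / t < 1 := (div_lt_one ht).2 h1
  have hlim : Filter.Tendsto (fun n : ℕ => (n : ℝ) * (r / t) ^ n) Filter.atTop (nhds 0) :=
    tendsto_self_mul_const_pow_of_lt_one (by positivity) hq
  obtain ⟨B, hB⟩ := hlim.bddAbove_range
  refine ⟨C * B / r, fun n => ?_⟩
  have hBn : ((n + 1 : ℕ) : ℝ) * (r / t) ^ (n + 1) ≤ B := hB ⟨n + 1, rfl⟩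
  have hn : ‖((n : ℂ) + 1)‖ = (n : ℝ) + 1 := by
    rw [show ((n : ℂ) + 1) = ((n + 1 : ℕ) : ℂ) by push_cast; ring, Complex.norm_natCast]
    push_cast; ring
  have hC0 : 0 ≤ C := le_trans (by positivity) (hC 0)
  rw [_root_.dcoeff, norm_mul, hn, le_div_iff₀ h0]
  calc ((n : ℝ) + 1) * ‖a (n + 1)‖ * r ^ n * r
      = (‖a (n + 1)‖ * t ^ (n + 1)) * (((n + 1 : ℕ) : ℝ) * (r / t) ^ (n + 1)) := by
        rw [div_pow]; push_cast; field_simp; ring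
    _ ≤ C * B := mul_le_mul (hC _) hBn (by positivity) hC0

theorem pser_hasDerivAt {R : ℝ} {a : ℕ → ℂ} (ha : ConvOn R a) {x : ℝ} (hx : |x| < R) :
    HasDerivAt (pser a) (pser (dcoeff a) x) x := by
  obtain ⟨r, h1, h2⟩ := exists_between hx
  have h0 : 0 < r := (abs_nonneg x).trans_lt h1
  have hu : Summable fun n => ‖dcoeff a n‖ * r ^ n := ha.dcoeff.summable_norm h0.le h2
  have hu' : Summable fun n : ℕ => (n : ℝ) * ‖a n‖ * r ^ (n - 1) := by
    rw [← summable_nat_add_iff 1]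
    refine hu.congr fun n => ?_
    have hn : ‖((n : ℂ) + 1)‖ = (n : ℝ) + 1 := by
      rw [show ((n : ℂ) + 1) = ((n + 1 : ℕ) : ℂ) by push_cast; ring, Complex.norm_natCast]
      push_cast; ring
    rw [dcoeff, norm_mul, hn]; push_cast; simp
  have key := hasDerivAt_tsum_of_isPreconnected (𝕜 := ℝ) (F := ℂ)
    (g := fun n (y : ℝ) => a n * (y : ℂ) ^ n)
    (g' := fun n (y : ℝ) => a n * ((n : ℂ) * (y : ℂ) ^ (n - 1)))
    (t := Metric.ball (0 : ℝ) r) (y₀ := 0) (y := x) hu' Metric.isOpen_ball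
    (convex_ball _ _).isPreconnected
    (fun n y _ => by
      have := ((hasDerivAt_id (y : ℂ)).pow n).comp_ofReal
      simpa using this.const_mul (a n))
    (fun n y hy => by
      have hy' : |y| ≤ r := by simpa using (mem_ball_zero_iff.1 hy).le
      rw [norm_mul, norm_mul, norm_pow, Complex.norm_natCast, Complex.norm_real, Real.norm_eq_abs]
      calc ‖a n‖ * (n * |y| ^ (n - 1)) = n * ‖a n‖ * |y| ^ (n - 1) := by ring
        _ ≤ _ := by gcongr)
    (by simpa using h0) (ha.summable (by simpa using h0.trans h2)) (by simpa using h1)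
  have e : pser (dcoeff a) x = ∑' n, a n * ((n : ℂ) * (x : ℂ) ^ (n - 1)) := by
    have hs : Summable fun n => a n * ((n : ℂ) * (x : ℂ) ^ (n - 1)) := by
      rw [← summable_nat_add_iff 1]
      refine (ha.dcoeff.summable hx).congr fun n => ?_
      simp [dcoeff]; ring
    rw [hs.tsum_eq_zero_add, pser]
    simp only [Nat.cast_zero, zero_mul, mul_zero, zero_add]
    refine tsum_congr fun n => ?_
    simp [dcoeff]; ring
  rw [e]
  exact key

theorem pser_contDiffOn {R : ℝ} (n : ℕ) {a : ℕ → ℂ} (ha : ConvOn R a) :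
    ContDiffOn ℝ n (pser a) (Set.Ioo (-R) R) := by
  induction n generalizing a with
  | zero =>
    exact contDiffOn_zero.2 fun x hx =>
      (pser_hasDerivAt ha (abs_lt.2 hx)).continuousAt.continuousWithinAt
  | succ n ih =>
    push_cast
    rw [contDiffOn_succ_iff_deriv_of_isOpen isOpen_Ioo]
    refine ⟨fun x hx => (pser_hasDerivAt ha (abs_lt.2 hx)).differentiableAt.differentiableWithinAt,
      by simp, (ih ha.dcoeff).congr fun x hx => (pser_hasDerivAt ha (abs_lt.2 hx)).deriv⟩

theorem ConvOn.xcoeff {R : ℝ} {a : ℕ → ℂ} (ha : ConvOn R a) : ConvOn R (xcoeff a) := by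
  intro r h0 hr
  obtain ⟨C, hC⟩ := ha r h0 hr
  have hC0 : 0 ≤ C := le_trans (by positivity) (hC 0)
  refine ⟨C * r, fun n => ?_⟩
  cases n with
  | zero => simpa [_root_.xcoeff] using by positivity
  | succ n =>
    calc ‖a n‖ * r ^ (n + 1) = (‖a n‖ * r ^ n) * r := by ring
      _ ≤ C * r := by gcongr; exact hC n

theorem ConvOn.hasSum {R : ℝ} {a : ℕ → ℂ} (ha : ConvOn R a) {x : ℝ} (hx : |x| < R) :
    HasSum (fun n => a n * (x : ℂ) ^ n) (pser a x) := (ha.summable hx).hasSum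

theorem pser_xcoeff {R : ℝ} {a : ℕ → ℂ} (ha : ConvOn R a) {x : ℝ} (hx : |x| < R) :
    pser (xcoeff a) x = x * pser a x := by
  rw [pser, (ha.xcoeff.summable hx).tsum_eq_zero_add, pser, ← tsum_mul_left]
  simp only [xcoeff, zero_mul, zero_add]
  exact tsum_congr fun n => by ring

theorem pser_zero (a : ℕ → ℂ) : pser a 0 = a 0 := by
  rw [pser, tsum_eq_single 0]
  · simp
  · intro n hn; simp [hn]

theorem ConvOn.of_norm_le_pow {R C K : ℝ} {a : ℕ → ℂ} (hK : 0 < K) (hR : R * K ≤ 1)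
    (h : ∀ n, ‖a n‖ ≤ C * K ^ n) : ConvOn R a := by
  intro r h0 hr
  have hC : 0 ≤ C := by simpa using (norm_nonneg _).trans (h 0)
  refine ⟨C, fun n => ?_⟩
  have : r * K ≤ 1 := (mul_le_mul_of_nonneg_right hr.le hK.le).trans hR
  calc ‖a n‖ * r ^ n ≤ C * K ^ n * r ^ n := by gcongr; exact h n
    _ = C * (r * K) ^ n := by rw [mul_pow]; ring
    _ ≤ C * 1 := by gcongr; exact pow_le_one₀ (by positivity) this
    _ = C := mul_one C

theorem ConvOn.of_norm_le_polynomial {C : ℝ} (k : ℕ) {a : ℕ → ℂ}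
    (h : ∀ n, ‖a n‖ ≤ C * ((n : ℝ) + 1) ^ k) : ConvOn 1 a := by
  intro r h0 hr
  have hC : 0 ≤ C := by simpa using (norm_nonneg _).trans (h 0)
  have hlim := (tendsto_pow_const_mul_const_pow_of_lt_one k h0.le hr)
  obtain ⟨B, hB⟩ := hlim.bddAbove_range
  refine ⟨C * B / r, fun n => ?_⟩
  have hBn : ((n + 1 : ℕ) : ℝ) ^ k * r ^ (n + 1) ≤ B := hB ⟨n + 1, rfl⟩
  rw [le_div_iff₀ h0]
  calc ‖a n‖ * r ^ n * r ≤ C * ((n : ℝ) + 1) ^ k * r ^ n * r := by gcongr; exact h n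
    _ = C * (((n + 1 : ℕ) : ℝ) ^ k * r ^ (n + 1)) := by push_cast; ring
    _ ≤ C * B := by gcongr

/-! ### The coefficients `p`, `w`, the expanded equation and the Wronskian. -/

theorem slP_pos {ε x : ℝ} (hx : x ∈ Set.Ioo (-1 : ℝ) 1) : 0 < slP ε x :=
  mul_pos (Real.rpow_pos_of_pos (by linarith [hx.2]) _) (Real.rpow_pos_of_pos (by linarith [hx.1]) _)

theorem slP_hasDerivAt {ε x : ℝ} (hx : x ∈ Set.Ioo (-1 : ℝ) 1) :
    HasDerivAt (slP ε) (-(2 / ε + 2 * x) / (1 - x ^ 2) * slP ε x) x := by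
  have h1 : 0 < 1 - x := by linarith [hx.2]
  have h2 : 0 < x + 1 := by linarith [hx.1]
  have d1 := ((hasDerivAt_id x).const_sub 1).rpow_const (p := 1 + 1 / ε) (Or.inl h1.ne')
  have d2 := ((hasDerivAt_id x).add_const 1).rpow_const (p := 1 - 1 / ε) (Or.inl h2.ne')
  have d := d1.mul d2
  refine d.congr_deriv ?_
  have e1 : (1 - x) ^ (1 + 1 / ε) = (1 - x) ^ (1 / ε) * (1 - x) := by
    rw [add_comm, Real.rpow_add h1, Real.rpow_one]
  have e2 : (x + 1) ^ (1 - 1 / ε) = (x + 1) ^ (-(1 / ε)) * (x + 1) := by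
    rw [sub_eq_neg_add, Real.rpow_add h2, Real.rpow_one]
  have e3 : 1 - x ^ 2 = (1 - x) * (x + 1) := by ring
  simp only [id, slP]
  rw [show 1 + 1 / ε - 1 = 1 / ε by ring, show 1 - 1 / ε - 1 = -(1 / ε) by ring, e1, e2, e3]
  field_simp
  ring

theorem slW_eq {ε x : ℝ} (hx : x ∈ Set.Ioo (0 : ℝ) 1) :
    slW ε x = slP ε x / (x * (1 - x ^ 2)) := by
  have h0 : 0 < x := hx.1
  have h1 : 0 < 1 - x := by linarith [hx.2]
  have h2 : 0 < x + 1 := by linarith [hx.1]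
  have e1 : (1 - x) ^ (1 + 1 / ε) = (1 - x) ^ (1 / ε) * (1 - x) := by
    rw [add_comm, Real.rpow_add h1, Real.rpow_one]
  have e2 : (x + 1) ^ (1 - 1 / ε) = (x + 1) ^ (-(1 / ε)) * (x + 1) := by
    rw [sub_eq_neg_add, Real.rpow_add h2, Real.rpow_one]
  have e3 : 1 - x ^ 2 = (1 - x) * (x + 1) := by ring
  rw [slW, slP, e1, e2, e3]
  field_simp

theorem slW_pos {ε x : ℝ} (hx : x ∈ Set.Ioo (0 : ℝ) 1) : 0 < slW ε x := by
  rw [slW_eq hx]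
  exact div_pos (slP_pos ⟨by linarith [hx.1], hx.2⟩)
    (mul_pos hx.1 (by nlinarith [hx.1, hx.2]))

/-- At the point `x`, the function `y` with first and second derivatives `y₁`, `y₂` satisfies
`x (1 - x²) y'' - 2 x (x + 1/ε) y' + m y = 0`, the expanded form of `-(p y')' = m w y`. -/
structure SolvesAt (ε : ℝ) (m : ℂ) (y y₁ y₂ : ℝ → ℂ) (x : ℝ) : Prop where
  hasDerivAt : HasDerivAt y (y₁ x) x
  hasDerivAt' : HasDerivAt y₁ (y₂ x) x
  eq : (x : ℂ) * (1 - (x : ℂ) ^ 2) * y₂ x - 2 * x * (x + 1 / (ε : ℂ)) * y₁ x + m * y x = 0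

theorem SolvesAt.sub_smul {ε : ℝ} {m c : ℂ} {y y₁ y₂ z z₁ z₂ : ℝ → ℂ} {x : ℝ}
    (hy : SolvesAt ε m y y₁ y₂ x) (hz : SolvesAt ε m z z₁ z₂ x) :
    SolvesAt ε m (fun t => y t - c * z t) (fun t => y₁ t - c * z₁ t)
      (fun t => y₂ t - c * z₂ t) x where
  hasDerivAt := hy.hasDerivAt.sub (hz.hasDerivAt.const_mul c)
  hasDerivAt' := hy.hasDerivAt'.sub (hz.hasDerivAt'.const_mul c)
  eq := by linear_combination hy.eq - c * hz.eq

/-- Since `p'/p = -(2x + 2/ε)/(1-x²)` and `w = p/(x(1-x²))`, a factor `w` splits off and a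
polynomial differential operator remains. This links the divergence form to the expanded form. -/
theorem hasDerivAt_slP_mul {ε x : ℝ} {y₁ : ℝ → ℂ} {d : ℂ} (hx : x ∈ Set.Ioo (0 : ℝ) 1)
    (h : HasDerivAt y₁ d x) :
    HasDerivAt (fun t => (slP ε t : ℂ) * y₁ t)
      ((slW ε x : ℂ) * ((x : ℂ) * (1 - (x : ℂ) ^ 2) * d - 2 * x * (x + 1 / (ε : ℂ)) * y₁ x)) x := by
  have hx' : x ∈ Set.Ioo (-1 : ℝ) 1 := ⟨by linarith [hx.1], hx.2⟩
  refine ((slP_hasDerivAt hx').ofReal_comp.mul h).congr_deriv ?_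
  have h0 : (x : ℂ) ≠ 0 := by exact_mod_cast hx.1.ne'
  have h1 : (1 - (x : ℂ) ^ 2) ≠ 0 := by
    have : 1 - x ^ 2 ≠ 0 := by nlinarith [hx.1, hx.2]
    exact_mod_cast this
  rw [slW_eq hx]
  push_cast
  field_simp
  ring

theorem SolvesAt.hasDerivAt_flux {ε : ℝ} {m : ℂ} {y y₁ y₂ : ℝ → ℂ} {x : ℝ}
    (h : SolvesAt ε m y y₁ y₂ x) (hx : x ∈ Set.Ioo (0 : ℝ) 1) :
    HasDerivAt (fun t => (slP ε t : ℂ) * y₁ t) (-(m * (slW ε x : ℂ) * y x)) x := by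
  refine (hasDerivAt_slP_mul hx h.hasDerivAt').congr_deriv ?_
  linear_combination (slW ε x : ℂ) * h.eq

theorem SolvesAt.of_flux {ε : ℝ} {m : ℂ} {y y₁ y₂ : ℝ → ℂ} {x : ℝ}
    (hx : x ∈ Set.Ioo (0 : ℝ) 1) (h1 : HasDerivAt y (y₁ x) x) (h2 : HasDerivAt y₁ (y₂ x) x)
    (h : -deriv (fun t : ℝ => (slP ε t : ℂ) * y₁ t) x = m * (slW ε x : ℂ) * y x) :
    SolvesAt ε m y y₁ y₂ x := by
  refine ⟨h1, h2, ?_⟩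
  rw [(hasDerivAt_slP_mul hx h2).deriv] at h
  have hw : (slW ε x : ℂ) ≠ 0 := by exact_mod_cast (slW_pos hx).ne'
  refine mul_left_cancel₀ hw ?_
  linear_combination -h

/-- Lagrange's identity: both solutions share the same `m`, so the terms in `w` cancel. -/
theorem SolvesAt.hasDerivAt_wronskian {ε : ℝ} {m : ℂ} {y y₁ y₂ z z₁ z₂ : ℝ → ℂ} {x : ℝ}
    (hx : x ∈ Set.Ioo (0 : ℝ) 1)
    (hy : SolvesAt ε m y y₁ y₂ x) (hz : SolvesAt ε m z z₁ z₂ x) :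
    HasDerivAt (fun t => y t * ((slP ε t : ℂ) * z₁ t) - z t * ((slP ε t : ℂ) * y₁ t)) 0 x := by
  refine ((hy.hasDerivAt.mul (hz.hasDerivAt_flux hx)).sub
    (hz.hasDerivAt.mul (hy.hasDerivAt_flux hx))).congr_deriv ?_
  ring

/-! ### Series solutions at `0` and at `1`. -/

/-- A sequence with the three-term recurrence below is the coefficient sequence of a solution. -/
theorem solvesAt_pser {ε : ℝ} {m : ℂ} {a : ℕ → ℂ} (ha : ConvOn 1 a) (h0 : a 0 = 0)
    (hrec : ∀ n : ℕ, ((n : ℂ) + 1) * (n + 2) * a (n + 2) =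
      (n + 1) * n * a n + (2 / (ε : ℂ) * (n + 1) - m) * a (n + 1))
    {x : ℝ} (hx : |x| < 1) :
    SolvesAt ε m (pser a) (pser (dcoeff a)) (pser (dcoeff (dcoeff a))) x := by
  refine ⟨pser_hasDerivAt ha hx, pser_hasDerivAt ha.dcoeff hx, ?_⟩
  have c1 := ha.dcoeff
  have c2 := c1.dcoeff
  have s1 := c2.xcoeff.hasSum hx
  have s2 := c2.xcoeff.xcoeff.xcoeff.hasSum hx
  have s3 := c1.xcoeff.xcoeff.hasSum hx
  have s4 := c1.xcoeff.hasSum hx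
  have s5 := ha.hasSum hx
  rw [pser_xcoeff c2 hx] at s1
  rw [pser_xcoeff c2.xcoeff.xcoeff hx, pser_xcoeff c2.xcoeff hx, pser_xcoeff c2 hx] at s2
  rw [pser_xcoeff c1.xcoeff hx, pser_xcoeff c1 hx] at s3
  rw [pser_xcoeff c1 hx] at s4
  have s := (((s1.sub s2).sub (s3.mul_left 2)).sub (s4.mul_left (2 / (ε : ℂ)))).add
    (s5.mul_left m)
  have z : HasSum (fun _ : ℕ => (0 : ℂ)) 0 := hasSum_zero
  have e := s.unique (z.congr_fun fun n => ?_)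
  · linear_combination e
  -- The coefficient of `x^(n+1)` is the recurrence at `n`; the constant term is `m * a 0`, which is
  -- where `h0` enters.
  · match n with
    | 0 => simp [xcoeff, h0]
    | 1 =>
      have := hrec 0
      simp [xcoeff, dcoeff] at this ⊢
      linear_combination (x : ℂ) * this
    | 2 =>
      have := hrec 1
      simp [xcoeff, dcoeff] at this ⊢
      linear_combination (x : ℂ) ^ 2 * this
    | n + 3 =>
      have := hrec (n + 2)
      simp [xcoeff, dcoeff] at this ⊢
      linear_combination (x : ℂ) ^ (n + 3) * this

/-- Coefficients, in powers of `1 - x`, of the solution that is regular at `x = 1`. -/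
noncomputable def frobCoeff (ε : ℝ) (m : ℂ) : ℕ → ℂ
  | 0 => 1
  | 1 => -m / (2 * (1 + 1 / (ε : ℂ)))
  | n + 2 => ((3 * ((n : ℂ) + 1) * n + 2 * (2 + 1 / (ε : ℂ)) * (n + 1) - m) * frobCoeff ε m (n + 1)
      - n * (n + 1) * frobCoeff ε m n) / (2 * (n + 2) * (n + 2 + 1 / (ε : ℂ)))

theorem norm_le_mul_pow_of_norm_le {a : ℕ → ℂ} {K : ℝ} (hK : 1 ≤ K)
    (h : ∀ n, ‖a (n + 2)‖ ≤ K * (‖a (n + 1)‖ + ‖a n‖)) (n : ℕ) :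
    ‖a n‖ ≤ (‖a 0‖ + ‖a 1‖) * (2 * K) ^ n ∧ ‖a (n + 1)‖ ≤ (‖a 0‖ + ‖a 1‖) * (2 * K) ^ (n + 1) := by
  induction n with
  | zero =>
    constructor
    · simp
    · have := norm_nonneg (a 0)
      have := norm_nonneg (a 1)
      simp only [zero_add, pow_one]
      nlinarith
  | succ n ih =>
    refine ⟨ih.2, (h n).trans ?_⟩
    set C := ‖a 0‖ + ‖a 1‖
    have hC : 0 ≤ C := by positivity
    have hq : 0 ≤ C * (2 * K) ^ n := by positivity
    calc K * (‖a (n + 1)‖ + ‖a n‖) ≤ K * (C * (2 * K) ^ (n + 1) + C * (2 * K) ^ n) := by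
          gcongr
          exacts [ih.2, ih.1]
      _ = (C * (2 * K) ^ n) * (K * (2 * K + 1)) := by ring
      _ ≤ (C * (2 * K) ^ n) * (2 * K) ^ 2 := by gcongr; nlinarith
      _ = _ := by ring

theorem frobCoeff_denom_ne_zero {ε : ℝ} (hε : 0 < ε) (n : ℕ) :
    ((n : ℂ) + 1 + 1 / (ε : ℂ)) ≠ 0 := by
  have : (n : ℝ) + 1 + 1 / ε ≠ 0 := by positivity
  exact_mod_cast this

/-- Both numerators are at most the constant times `(n+2)²`, and the denominator is at least
`(n+2)²`. -/
theorem frobCoeff_norm_le {ε : ℝ} (hε : 0 < ε) (m : ℂ) (n : ℕ) :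
    ‖frobCoeff ε m (n + 2)‖ ≤
      (7 + 2 * (1 / ε) + ‖m‖) * (‖frobCoeff ε m (n + 1)‖ + ‖frobCoeff ε m n‖) := by
  rw [frobCoeff]
  set u := frobCoeff ε m (n + 1)
  set w := frobCoeff ε m n
  have hα : 0 < 1 / ε := by positivity
  have hd : ‖(2 * ((n : ℂ) + 2) * (n + 2 + 1 / (ε : ℂ)))‖ = 2 * (n + 2) * (n + 2 + 1 / ε) := by
    have : (2 * ((n : ℂ) + 2) * (n + 2 + 1 / (ε : ℂ)))
        = ((2 * (n + 2) * (n + 2 + 1 / ε) : ℝ) : ℂ) := by push_cast; ring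
    rw [this, Complex.norm_real, Real.norm_of_nonneg (by positivity)]
  have h1 : ‖(3 * ((n : ℂ) + 1) * n + 2 * (2 + 1 / (ε : ℂ)) * (n + 1) - m)‖
      ≤ 3 * (n + 1) * n + 2 * (2 + 1 / ε) * (n + 1) + ‖m‖ := by
    have : (3 * ((n : ℂ) + 1) * n + 2 * (2 + 1 / (ε : ℂ)) * (n + 1))
        = ((3 * (n + 1) * n + 2 * (2 + 1 / ε) * (n + 1) : ℝ) : ℂ) := by push_cast; ring
    refine (norm_sub_le _ _).trans ?_
    rw [this, Complex.norm_real, Real.norm_of_nonneg (by positivity)]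
  have h2 : ‖(n : ℂ) * (n + 1)‖ = n * (n + 1) := by
    have : ((n : ℂ) * (n + 1)) = ((n * (n + 1) : ℝ) : ℂ) := by push_cast; ring
    rw [this, Complex.norm_real, Real.norm_of_nonneg (by positivity)]
  rw [norm_div, hd, div_le_iff₀ (by positivity)]
  set α := 1 / ε
  have hn : (0 : ℝ) ≤ n := n.cast_nonneg
  have hm := norm_nonneg m
  have hu := norm_nonneg u
  have hw := norm_nonneg w
  have hD : ((n : ℝ) + 2) ^ 2 ≤ 2 * (n + 2) * (n + 2 + α) := by nlinarith
  have hA : 3 * ((n : ℝ) + 1) * n + 2 * (2 + α) * (n + 1) + ‖m‖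
      ≤ (7 + 2 * α + ‖m‖) * (n + 2) ^ 2 := by
    nlinarith [mul_nonneg hm hn, mul_nonneg hα.le hn, mul_nonneg hm (mul_nonneg hn hn),
      mul_nonneg hα.le (mul_nonneg hn hn)]
  have hB : (n : ℝ) * (n + 1) ≤ (7 + 2 * α + ‖m‖) * (n + 2) ^ 2 := by
    nlinarith [mul_nonneg hm hn, mul_nonneg hα.le hn, mul_nonneg hm (mul_nonneg hn hn),
      mul_nonneg hα.le (mul_nonneg hn hn)]
  calc _ ≤ ‖(3 * ((n : ℂ) + 1) * n + 2 * (2 + 1 / (ε : ℂ)) * (n + 1) - m)‖ * ‖u‖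
          + ‖(n : ℂ) * (n + 1)‖ * ‖w‖ := by
        rw [← norm_mul, ← norm_mul]; exact norm_sub_le _ _
    _ ≤ (7 + 2 * α + ‖m‖) * (n + 2) ^ 2 * ‖u‖ + (7 + 2 * α + ‖m‖) * (n + 2) ^ 2 * ‖w‖ := by
        rw [h2]
        gcongr
        exact h1.trans hA
    _ = (7 + 2 * α + ‖m‖) * (‖u‖ + ‖w‖) * (n + 2) ^ 2 := by ring
    _ ≤ _ := by gcongr

/-- A crude geometric bound suffices: only a neighbourhood of `x = 1` matters, not the true radius.
-/
theorem exists_convOn_frobCoeff {ε : ℝ} (hε : 0 < ε) (m : ℂ) :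
    ∃ δ, 0 < δ ∧ δ ≤ 1 ∧ ConvOn δ (frobCoeff ε m) := by
  set K := 7 + 2 * (1 / ε) + ‖m‖ with hK
  have hK1 : 1 ≤ K := by
    have : 0 < 1 / ε := by positivity
    have := norm_nonneg m
    linarith
  refine ⟨1 / (2 * K), by positivity, ?_, ConvOn.of_norm_le_pow (K := 2 * K) (by positivity) ?_
    fun n => (norm_le_mul_pow_of_norm_le hK1 (frobCoeff_norm_le hε m) n).1⟩
  · rw [div_le_one (by positivity)]; linarith
  · rw [one_div, inv_mul_cancel₀ (by positivity)]

/-- With `s = 1 - x` the equation reads `s(1-s)(2-s)y'' + 2(1-s)(1+1/ε-s)y' + my = 0`. The exponents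
at `s = 0` are `0` and `-1/ε`, so the recurrence for exponent `0` never divides by zero. -/
theorem solvesAt_frobenius {ε : ℝ} (hε : 0 < ε) {m : ℂ} {δ : ℝ} {x : ℝ}
    (hc : ConvOn δ (frobCoeff ε m)) (hx : |1 - x| < δ) :
    SolvesAt ε m (fun t => pser (frobCoeff ε m) (1 - t))
      (fun t => -pser (dcoeff (frobCoeff ε m)) (1 - t))
      (fun t => pser (dcoeff (dcoeff (frobCoeff ε m))) (1 - t)) x := by
  have hs : HasDerivAt (fun t : ℝ => 1 - t) (-1) x := by
    simpa using (hasDerivAt_id x).const_sub 1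
  refine ⟨?_, ?_, ?_⟩
  · exact ((pser_hasDerivAt hc hx).scomp x hs).congr_deriv (by simp)
  · exact ((pser_hasDerivAt hc.dcoeff hx).scomp x hs).neg.congr_deriv (by simp)
  set s := 1 - x with hsx
  have hxs : (x : ℂ) = 1 - (s : ℂ) := by rw [hsx]; push_cast; ring
  have c1 := hc.dcoeff
  have c2 := c1.dcoeff
  have t1 := c2.xcoeff.hasSum hx
  have t2 := c2.xcoeff.xcoeff.hasSum hx
  have t3 := c2.xcoeff.xcoeff.xcoeff.hasSum hx
  have t4 := c1.hasSum hx
  have t5 := c1.xcoeff.hasSum hx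
  have t6 := c1.xcoeff.xcoeff.hasSum hx
  have t7 := hc.hasSum hx
  rw [pser_xcoeff c2 hx] at t1
  rw [pser_xcoeff c2.xcoeff hx, pser_xcoeff c2 hx] at t2
  rw [pser_xcoeff c2.xcoeff.xcoeff hx, pser_xcoeff c2.xcoeff hx, pser_xcoeff c2 hx] at t3
  rw [pser_xcoeff c1 hx] at t5
  rw [pser_xcoeff c1.xcoeff hx, pser_xcoeff c1 hx] at t6
  have t := ((((((t1.mul_left 2).sub (t2.mul_left 3)).add t3).add
    (t4.mul_left (2 * (1 + 1 / (ε : ℂ))))).sub (t5.mul_left (2 * (2 + 1 / (ε : ℂ))))).add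
    (t6.mul_left 2)).add (t7.mul_left m)
  have z : HasSum (fun _ : ℕ => (0 : ℂ)) 0 := hasSum_zero
  have rec1 : 2 * (1 + 1 / (ε : ℂ)) * frobCoeff ε m 1 = -m * frobCoeff ε m 0 := by
    have := frobCoeff_denom_ne_zero hε 0
    simp only [Nat.cast_zero, zero_add] at this
    rw [frobCoeff, frobCoeff, mul_one, mul_div_cancel₀]
    exact mul_ne_zero two_ne_zero this
  have rec2 (n : ℕ) : 2 * ((n : ℂ) + 2) * (n + 2 + 1 / (ε : ℂ)) * frobCoeff ε m (n + 2) =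
      (3 * ((n : ℂ) + 1) * n + 2 * (2 + 1 / (ε : ℂ)) * (n + 1) - m) * frobCoeff ε m (n + 1)
      - n * (n + 1) * frobCoeff ε m n := by
    have h1 := frobCoeff_denom_ne_zero hε (n + 1)
    have h2 : (n : ℂ) + 2 ≠ 0 := by exact_mod_cast (Nat.succ_ne_zero (n + 1))
    have h3 : (n : ℂ) + 2 + 1 / (ε : ℂ) ≠ 0 := by
      convert h1 using 1; push_cast; ring
    rw [frobCoeff, mul_div_cancel₀]
    exact mul_ne_zero (mul_ne_zero two_ne_zero h2) h3
  have e := t.unique (z.congr_fun fun n => ?_)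
  · rw [hxs]
    linear_combination e
  · generalize frobCoeff ε m = c at *
    match n with
    | 0 =>
      simp [xcoeff, dcoeff] at rec1 ⊢
      linear_combination rec1
    | 1 =>
      have := rec2 0
      simp [xcoeff, dcoeff] at this ⊢
      linear_combination (s : ℂ) * this
    | 2 =>
      have := rec2 1
      simp [xcoeff, dcoeff] at this ⊢
      linear_combination (s : ℂ) ^ 2 * this
    | n + 3 =>
      have := rec2 (n + 2)
      simp [xcoeff, dcoeff] at this ⊢
      linear_combination (s : ℂ) ^ (n + 3) * this

/-! ### From square-summable coefficients to a smooth eigenfunction. -/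

/-- Growth at `1` of a power series whose coefficients are at most `n + 1` times a
square-summable sequence. -/
theorem norm_pser_le_of_summable_sq {g q : ℕ → ℂ} (hq : Summable fun n => ‖q n‖ ^ 2)
    (hg : ∀ n, ‖g n‖ ≤ ((n : ℝ) + 1) * ‖q n‖) {x : ℝ} (hx : x ∈ Set.Ico (0 : ℝ) 1) :
    ‖pser g x‖ ≤ (∑' n, ‖q n‖ ^ 2 + 2) * (1 - x) ^ (-(3 / 2) : ℝ) := by
  have hs : 0 < 1 - x := by linarith [hx.2]
  -- Weight balancing `AB ≤ tA² + B²/t`: here `∑ (n+1)² x^(2n) ≤ 2/(1-x²)³ ≤ 2t²`, so both parts are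
  -- of order `t`.
  set t := (1 - x) ^ (-(3 / 2) : ℝ) with ht
  have ht0 : 0 < t := Real.rpow_pos_of_pos hs _
  have ht2 : t * t * (1 - x) ^ 3 = 1 := by
    rw [ht, ← Real.rpow_add hs, ← Real.rpow_natCast, ← Real.rpow_add hs]
    norm_num
  have hy0 : 0 ≤ x ^ 2 := sq_nonneg x
  have hy1 : x ^ 2 < 1 := by nlinarith [hx.1, hx.2]
  have hgeo := hasSum_choose_mul_geometric_of_norm_lt_one (𝕜 := ℝ) 2 (r := x ^ 2)
    (by rwa [Real.norm_of_nonneg hy0])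
  have hbd : ∀ n, ‖g n * (x : ℂ) ^ n‖ ≤
      t * ‖q n‖ ^ 2 + 2 / t * (((n + 2).choose 2 : ℝ) * (x ^ 2) ^ n) := by
    intro n
    have hch : ((n : ℝ) + 1) ^ 2 ≤ 2 * ((n + 2).choose 2 : ℝ) := by
      rw [Nat.cast_choose_two]; push_cast; nlinarith [(n.cast_nonneg : (0 : ℝ) ≤ n)]
    rw [norm_mul, norm_pow, Complex.norm_real, Real.norm_of_nonneg hx.1]
    set A := ‖q n‖
    set B := ((n : ℝ) + 1) * x ^ n with hB
    have hAB : A * B ≤ t * A ^ 2 + B ^ 2 / t := by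
      have : t * A ^ 2 + B ^ 2 / t - A * B = ((t * A - B) ^ 2 + t * A * B) / t := by
        field_simp; ring
      have h0 : 0 ≤ ((t * A - B) ^ 2 + t * A * B) / t := by
        have : 0 ≤ A := norm_nonneg _
        have : 0 ≤ B := mul_nonneg (by positivity) (pow_nonneg hx.1 n)
        positivity
      linarith
    calc ‖g n‖ * x ^ n ≤ ((n : ℝ) + 1) * ‖q n‖ * x ^ n :=
          mul_le_mul_of_nonneg_right (hg n) (pow_nonneg hx.1 n)
      _ = A * B := by rw [hB]; ring
      _ ≤ t * A ^ 2 + B ^ 2 / t := hAB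
      _ = t * A ^ 2 + ((n : ℝ) + 1) ^ 2 * (x ^ 2) ^ n / t := by
          rw [hB, mul_pow, ← pow_mul, ← pow_mul, mul_comm n 2]
      _ ≤ t * A ^ 2 + 2 * ((n + 2).choose 2 : ℝ) * (x ^ 2) ^ n / t := by gcongr
      _ = _ := by ring
  have hsum := (hq.hasSum.mul_left t).add (hgeo.mul_left (2 / t))
  refine (tsum_of_norm_bounded hsum hbd).trans ?_
  have h3 : 1 / (1 - x ^ 2) ^ (2 + 1) ≤ 1 / (1 - x) ^ 3 := by
    have : 1 - x ≤ 1 - x ^ 2 := by nlinarith [hx.1, hx.2]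
    gcongr
  have h4 : 2 / t * (1 / (1 - x) ^ 3) = 2 * t := by
    field_simp
    linarith
  have : 2 / t * (1 / (1 - x ^ 2) ^ (2 + 1)) ≤ 2 * t := by
    rw [← h4]; gcongr
  linarith

/-- The exponents add up to `-3/2 + 1 + 1/ε = 1/ε - 1/2`, which is positive exactly because `ε < 2`.
-/
theorem tendsto_pser_mul_slP {ε : ℝ} (hε : ε ∈ Set.Ioo (0 : ℝ) 2) {g q : ℕ → ℂ}
    (hq : Summable fun n => ‖q n‖ ^ 2) (hg : ∀ n, ‖g n‖ ≤ ((n : ℝ) + 1) * ‖q n‖) :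
    Filter.Tendsto (fun x => pser g x * (slP ε x : ℂ)) (nhdsWithin 1 (Set.Iio 1)) (nhds 0) := by
  set V := ∑' n, ‖q n‖ ^ 2 + 2
  have hα : 0 < 1 / ε - 1 / 2 := by
    have := one_div_lt_one_div_of_lt hε.1 hε.2
    linarith
  have hlim : Filter.Tendsto (fun x : ℝ => V * (1 - x) ^ (1 / ε - 1 / 2) * (x + 1) ^ (1 - 1 / ε))
      (nhdsWithin 1 (Set.Iio 1)) (nhds 0) := by
    have hc : ContinuousAt (fun x : ℝ => V * (1 - x) ^ (1 / ε - 1 / 2) * (x + 1) ^ (1 - 1 / ε)) 1 := by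
      refine ContinuousAt.mul (ContinuousAt.mul continuousAt_const ?_) ?_
      · exact ContinuousAt.rpow_const (by fun_prop) (Or.inr hα.le)
      · exact ContinuousAt.rpow_const (by fun_prop) (Or.inl (by norm_num))
    have := hc.tendsto.mono_left (nhdsWithin_le_nhds (s := Set.Iio 1))
    rwa [sub_self, Real.zero_rpow hα.ne', mul_zero, zero_mul] at this
  refine squeeze_zero_norm' ?_ hlim
  have hmem : Set.Ioo (0 : ℝ) 1 ∈ nhdsWithin (1 : ℝ) (Set.Iio 1) := Ioo_mem_nhdsLT zero_lt_one
  filter_upwards [hmem] with x hx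
  have hs : 0 < 1 - x := by linarith [hx.2]
  have hp : 0 < slP ε x := slP_pos ⟨by linarith [hx.1], hx.2⟩
  rw [norm_mul, Complex.norm_real, Real.norm_of_nonneg hp.le]
  calc ‖pser g x‖ * slP ε x ≤ V * (1 - x) ^ (-(3 / 2) : ℝ) * slP ε x := by
        gcongr; exact norm_pser_le_of_summable_sq hq hg ⟨hx.1.le, hx.2⟩
    _ = _ := by
        have e : (1 - x) ^ (1 / ε - 1 / 2) = (1 - x) ^ (-(3 / 2) : ℝ) * (1 - x) ^ (1 + 1 / ε) := by
          rw [← Real.rpow_add hs]; congr 1; ring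
        rw [slP, e]; ring

/-- A power series solution with square-summable coefficients is, near `1`, a multiple of the
solution that is regular at `1`. -/
theorem exists_eq_mul_frobenius {ε : ℝ} (hε : ε ∈ Set.Ioo (0 : ℝ) 2) {m : ℂ} {a : ℕ → ℂ}
    (hsq : Summable fun n => ‖a n‖ ^ 2)
    (hsol : ∀ x ∈ Set.Ioo (0 : ℝ) 1,
      SolvesAt ε m (pser a) (pser (dcoeff a)) (pser (dcoeff (dcoeff a))) x)
    {δ : ℝ} (hδ : 0 < δ) (hδ1 : δ ≤ 1) (hc : ConvOn δ (frobCoeff ε m)) :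
    ∃ C : ℂ, ∃ r < 1, ∀ x ∈ Set.Ioo r 1, pser a x = C * pser (frobCoeff ε m) (1 - x) := by
  set h : ℝ → ℂ := fun t => pser (frobCoeff ε m) (1 - t) with hh
  set h₁ : ℝ → ℂ := fun t => -pser (dcoeff (frobCoeff ε m)) (1 - t) with hh₁
  have hsolh : ∀ x, |1 - x| < δ → SolvesAt ε m h h₁ _ x := fun x hx =>
    solvesAt_frobenius hε.1 hc hx
  have hone := hsolh 1 (by simpa using hδ)
  have hcont : ContinuousAt h 1 := hone.hasDerivAt.continuousAt
  have hcont₁ : ContinuousAt h₁ 1 := hone.hasDerivAt'.continuousAt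
  have h1 : h 1 ≠ 0 := by simp [hh, pser_zero, frobCoeff]
  obtain ⟨ρ, hρ, hρh⟩ := Metric.eventually_nhds_iff.1 (hcont.eventually_ne h1)
  set r := max (1 - δ) (1 - ρ) with hr
  have hr1 : r < 1 := max_lt (by linarith) (by linarith)
  have hr0 : 0 ≤ r := le_max_of_le_left (by linarith)
  have hsub : ∀ x ∈ Set.Ioo r 1, x ∈ Set.Ioo (0 : ℝ) 1 ∧ |1 - x| < δ ∧ h x ≠ 0 := by
    intro x hx
    have e1 : 1 - δ < x := (le_max_left _ _).trans_lt hx.1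
    have e2 : 1 - ρ < x := (le_max_right _ _).trans_lt hx.1
    refine ⟨⟨hr0.trans_lt hx.1, hx.2⟩, ?_, hρh ?_⟩
    · rw [abs_of_pos (by linarith [hx.2])]; linarith
    · rw [Real.dist_eq, abs_sub_comm, abs_of_pos (by linarith [hx.2])]; linarith
  -- The `p`-weighted Wronskian is constant on `(r, 1)` and tends to `0` at `1`, so it vanishes.
  set W : ℝ → ℂ := fun t =>
    pser a t * ((slP ε t : ℂ) * h₁ t) - h t * ((slP ε t : ℂ) * pser (dcoeff a) t) with hW
  have hWd : ∀ x ∈ Set.Ioo r 1, HasDerivAt W 0 x := fun x hx =>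
    (hsol x (hsub x hx).1).hasDerivAt_wronskian (hsub x hx).1 (hsolh x (hsub x hx).2.1)
  have hWlim : Filter.Tendsto W (nhdsWithin 1 (Set.Iio 1)) (nhds 0) := by
    have l1 := tendsto_pser_mul_slP hε hsq (g := a)
      (fun n => le_mul_of_one_le_left (norm_nonneg _) (by simp))
    have l2 := tendsto_pser_mul_slP hε ((summable_nat_add_iff 1).2 hsq) (g := dcoeff a)
      (fun n => by
        have hn : ‖((n : ℂ) + 1)‖ = (n : ℝ) + 1 := by
          rw [show ((n : ℂ) + 1) = ((n + 1 : ℕ) : ℂ) by push_cast; ring, Complex.norm_natCast]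
          push_cast; ring
        rw [dcoeff, norm_mul, hn])
    have l3 := hcont.tendsto.mono_left (nhdsWithin_le_nhds (s := Set.Iio 1))
    have l4 := hcont₁.tendsto.mono_left (nhdsWithin_le_nhds (s := Set.Iio 1))
    have := (l1.mul l4).sub (l3.mul l2)
    simp only [zero_mul, mul_zero, sub_zero] at this
    refine this.congr fun x => ?_
    rw [hW]; ring
  have hW0 : ∀ x ∈ Set.Ioo r 1, W x = 0 := by
    intro x hx
    have hconst : ∀ y ∈ Set.Ioo r 1, W y = W x := fun y hy =>
      isOpen_Ioo.is_const_of_deriv_eq_zero isPreconnected_Ioo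
        (fun z hz => (hWd z hz).differentiableAt.differentiableWithinAt)
        (fun z hz => (hWd z hz).deriv) hy hx
    have : Filter.Tendsto W (nhdsWithin 1 (Set.Iio 1)) (nhds (W x)) := by
      refine tendsto_const_nhds.congr' ?_
      filter_upwards [Ioo_mem_nhdsLT hr1] with y hy using (hconst y hy).symm
    exact tendsto_nhds_unique this hWlim
  -- The derivative of the quotient is minus the Wronskian over `p h²`, hence `0`.
  have hquot : ∀ x ∈ Set.Ioo r 1, HasDerivAt (fun t => pser a t / h t) 0 x := by
    intro x hx
    obtain ⟨hx1, hx2, hx3⟩ := hsub x hx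
    refine ((hsol x hx1).hasDerivAt.div (hsolh x hx2).hasDerivAt hx3).congr_deriv ?_
    have hp : (slP ε x : ℂ) ≠ 0 := by
      exact_mod_cast (slP_pos ⟨by linarith [hx1.1], hx1.2⟩).ne'
    have e : pser (dcoeff a) x * h x - pser a x * h₁ x = 0 := by
      refine mul_left_cancel₀ hp ?_
      have := hW0 x hx
      simp only [hW] at this
      linear_combination -this
    rw [e, zero_div]
  obtain ⟨x₀, hx₀⟩ : (Set.Ioo r 1).Nonempty := Set.nonempty_Ioo.2 hr1
  refine ⟨pser a x₀ / h x₀, r, hr1, fun x hx => ?_⟩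
  have : pser a x / h x = pser a x₀ / h x₀ :=
    isOpen_Ioo.is_const_of_deriv_eq_zero isPreconnected_Ioo
      (fun z hz => (hquot z hz).differentiableAt.differentiableWithinAt)
      (fun z hz => (hquot z hz).deriv) hx hx₀
  rw [← this, div_mul_cancel₀ _ (hsub x hx).2.2]

theorem isSLEigenvalue_of_summable_sq {ε : ℝ} (hε : ε ∈ Set.Ioo (0 : ℝ) 2) {m : ℂ} {a : ℕ → ℂ}
    (hsq : Summable fun n => ‖a n‖ ^ 2) (h0 : a 0 = 0) (h1 : a 1 ≠ 0)
    (hrec : ∀ n : ℕ, ((n : ℂ) + 1) * (n + 2) * a (n + 2) =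
      (n + 1) * n * a n + (2 / (ε : ℂ) * (n + 1) - m) * a (n + 1)) :
    IsSLEigenvalue ε m := by
  have ha : ConvOn 1 a := by
    obtain ⟨B, hB⟩ := hsq.tendsto_atTop_zero.bddAbove_range
    refine ConvOn.of_norm_le_polynomial (C := B + 1) 0 fun n => ?_
    have : ‖a n‖ ^ 2 ≤ B := hB ⟨n, rfl⟩
    rw [pow_zero, mul_one]
    nlinarith [sq_nonneg (‖a n‖ - 1)]
  have hsol : ∀ x ∈ Set.Ioo (0 : ℝ) 1,
      SolvesAt ε m (pser a) (pser (dcoeff a)) (pser (dcoeff (dcoeff a))) x := fun x hx =>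
    solvesAt_pser ha h0 hrec (by rw [abs_of_pos hx.1]; exact hx.2)
  obtain ⟨δ, hδ, hδ1, hc⟩ := exists_convOn_frobCoeff hε.1 m
  obtain ⟨C, r, hr, hC⟩ := exists_eq_mul_frobenius hε hsq hsol hδ hδ1 hc
  classical
  -- The two formulas agree on `(r, 1)`, so near `1` the glued function is the Frobenius series,
  -- smooth on both sides.
  set u : ℝ → ℂ := fun x => if x < 1 then pser a x else C * pser (frobCoeff ε m) (1 - x) with hu
  have hlt : ∀ x < 1, u =ᶠ[nhds x] pser a := fun x hx => by
    filter_upwards [Iio_mem_nhds hx] with y hy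
    exact if_pos hy
  refine ⟨u, ?_, ?_, ?_, ?_⟩
  · rw [contDiffOn_infty]
    intro n x hx
    refine ContDiffAt.contDiffWithinAt ?_
    rcases hx.2.lt_or_eq with hx1 | rfl
    · exact ((pser_contDiffOn n ha).contDiffAt
        (Ioo_mem_nhds (by linarith [hx.1]) hx1)).congr_of_eventuallyEq (hlt x hx1)
    · have hs : ContDiffAt ℝ n (fun t : ℝ => C * pser (frobCoeff ε m) (1 - t)) 1 := by
        refine contDiffAt_const.mul ?_
        refine ContDiffAt.comp (1 : ℝ) (g := pser (frobCoeff ε m)) (f := fun t : ℝ => 1 - t) ?_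
          (by fun_prop)
        exact (pser_contDiffOn n hc).contDiffAt
          (Ioo_mem_nhds (by linarith) (by linarith))
      refine hs.congr_of_eventuallyEq ?_
      filter_upwards [Ioi_mem_nhds hr] with y hy
      simp only [hu]
      split_ifs with h
      · exact hC y ⟨hy, h⟩
      · rfl
  · simp [hu, pser_zero, h0]
  -- If `u` vanished on `[0,1]`, its one-sided derivative `a 1` at `0` would be zero.
  · by_contra! hz
    have hd : HasDerivWithinAt (pser a) (a 1) (Set.Icc 0 1) 0 := by
      have := (pser_hasDerivAt ha (x := 0) (by simp)).hasDerivWithinAt (s := Set.Icc 0 1)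
      simpa [pser_zero, dcoeff] using this
    have hd0 : HasDerivWithinAt (pser a) 0 (Set.Icc 0 1) 0 := by
      refine (hasDerivWithinAt_const (0 : ℝ) (Set.Icc (0 : ℝ) 1) (0 : ℂ)).congr_of_eventuallyEq ?_
        (by rw [pser_zero, h0])
      filter_upwards [self_mem_nhdsWithin, mem_nhdsWithin_of_mem_nhds (Iio_mem_nhds one_pos)]
        with y hy hy1
      rw [← hz y hy]
      exact (hlt y hy1).eq_of_nhds.symm
    exact h1 ((uniqueDiffOn_Icc zero_lt_one 0 (by simp)).eq_deriv _ hd hd0)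
  · intro x hx
    have hev : (fun y : ℝ => (slP ε y : ℂ) * deriv u y) =ᶠ[nhds x]
        fun y => (slP ε y : ℂ) * pser (dcoeff a) y := by
      filter_upwards [Ioo_mem_nhds hx.1 hx.2] with y hy
      rw [(hlt y hy.2).deriv_eq, (hsol y hy).hasDerivAt.deriv]
    rw [hev.deriv_eq, ((hsol x hx).hasDerivAt_flux hx).deriv, neg_neg, (hlt x hx.2).eq_of_nhds]

/-! ### Uniqueness at `0` and reality of the eigenvalues. -/

/-- Uniqueness at the singular endpoint `0`: a solution with `y(0) = y'(0) = 0` vanishes. -/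
theorem eq_zero_of_solvesAt {ε : ℝ} (hε : 0 < ε) {m : ℂ} {y y₁ y₂ : ℝ → ℂ}
    (hsol : ∀ x ∈ Set.Ioo (0 : ℝ) 1, SolvesAt ε m y y₁ y₂ x)
    (h1 : Filter.Tendsto (fun x => ‖y₁ x‖ ^ 2) (nhdsWithin 0 (Set.Ioi 0)) (nhds 0))
    (h0 : Filter.Tendsto (fun x => ‖y x‖ ^ 2 / x) (nhdsWithin 0 (Set.Ioi 0)) (nhds 0)) :
    ∀ x ∈ Set.Ioo (0 : ℝ) 1, y x = 0 := by
  intro r hr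
  have hr2 : 0 < 1 - r ^ 2 := by nlinarith [hr.1, hr.2]
  set A := 2 * (1 + 1 / ε) + ‖m‖ with hA
  have hA0 : 0 ≤ A := by positivity
  set C := A / (1 - r ^ 2) with hC
  have hC0 : 0 ≤ C := by positivity
  have hbound : ∀ x ∈ Set.Ioc 0 r, ‖y₂ x‖ ≤ C * (‖y₁ x‖ + ‖y x‖ / x) := by
    intro x hx
    have hx0 : 0 < x := hx.1
    have hx1 : x < 1 := hx.2.trans_lt hr.2
    have hq : 0 < 1 - x ^ 2 := by nlinarith
    have e := (hsol x ⟨hx0, hx1⟩).eq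
    have n1 : x * (1 - x ^ 2) * ‖y₂ x‖ = ‖(x : ℂ) * (1 - (x : ℂ) ^ 2) * y₂ x‖ := by
      have : (x : ℂ) * (1 - (x : ℂ) ^ 2) = ((x * (1 - x ^ 2) : ℝ) : ℂ) := by push_cast; ring
      rw [this, norm_mul, Complex.norm_real, Real.norm_of_nonneg (by positivity)]
    have n2 : ‖2 * (x : ℂ) * (x + 1 / (ε : ℂ)) * y₁ x‖ = 2 * x * (x + 1 / ε) * ‖y₁ x‖ := by
      have : 2 * (x : ℂ) * (x + 1 / (ε : ℂ)) = ((2 * x * (x + 1 / ε) : ℝ) : ℂ) := by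
        push_cast; ring
      rw [this, norm_mul, Complex.norm_real, Real.norm_of_nonneg (by positivity)]
    have n3 : (x : ℂ) * (1 - (x : ℂ) ^ 2) * y₂ x
        = 2 * x * (x + 1 / (ε : ℂ)) * y₁ x - m * y x := by linear_combination e
    have hy := norm_nonneg (y x)
    have hy1 := norm_nonneg (y₁ x)
    have hm := norm_nonneg m
    have n4 : x * (1 - x ^ 2) * ‖y₂ x‖ ≤ x * (A * (‖y₁ x‖ + ‖y x‖ / x)) := by
      rw [n1, n3]
      refine (norm_sub_le _ _).trans ?_
      rw [n2, norm_mul]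
      have e1 : x * (A * (‖y₁ x‖ + ‖y x‖ / x)) = x * A * ‖y₁ x‖ + A * ‖y x‖ := by field_simp
      have e2 : 2 * x * (x + 1 / ε) ≤ x * A := by
        have : 2 * (x + 1 / ε) ≤ A := by linarith
        nlinarith
      have e3 : ‖m‖ ≤ A := by
        have : 0 < 1 / ε := by positivity
        linarith
      rw [e1]
      gcongr
    have n5 : (1 - x ^ 2) * ‖y₂ x‖ ≤ A * (‖y₁ x‖ + ‖y x‖ / x) := by
      refine le_of_mul_le_mul_left ?_ hx0
      linarith
    have n6 : (1 - r ^ 2) * ‖y₂ x‖ ≤ A * (‖y₁ x‖ + ‖y x‖ / x) := by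
      refine le_trans ?_ n5
      have : 1 - r ^ 2 ≤ 1 - x ^ 2 := by nlinarith [hx.2]
      gcongr
    rw [hC, div_mul_eq_mul_div, le_div_iff₀ hr2]
    linarith
  -- For the energy `E = |y'|² + |y|²/x`, put `p = |y'|` and `q = |y|/x`. Then `E' ≤ 2Cp² + 2(C+1)pq
  -- - q² ≤ Kp² ≤ KE` by completing the square. The `-q²` from differentiating `1/x` absorbs the
  -- singular term, and Gronwall applies.
  set K := 2 * C + (C + 1) ^ 2 with hK
  set E : ℝ → ℝ := fun x => ‖y₁ x‖ ^ 2 + ‖y x‖ ^ 2 / x with hE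
  set F : ℝ → ℝ := fun x => Real.exp (-K * x) * E x with hF
  have hEd : ∀ x ∈ Set.Ioc 0 r, HasDerivAt E (2 * inner ℝ (y₁ x) (y₂ x) +
      (2 * inner ℝ (y x) (y₁ x) * x - ‖y x‖ ^ 2 * 1) / x ^ 2) x := by
    intro x hx
    have s := hsol x ⟨hx.1, hx.2.trans_lt hr.2⟩
    exact s.hasDerivAt'.norm_sq.add (s.hasDerivAt.norm_sq.div (hasDerivAt_id x) hx.1.ne')
  have hFd : ∀ x ∈ Set.Ioc 0 r, ∃ d ≤ 0, HasDerivAt F d x := by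
    intro x hx
    have hx0 : 0 < x := hx.1
    have hexp : HasDerivAt (fun x : ℝ => Real.exp (-K * x)) (Real.exp (-K * x) * (-K)) x := by
      simpa using ((hasDerivAt_id x).const_mul (-K)).exp
    refine ⟨_, ?_, hexp.mul (hEd x hx)⟩
    have i1 : inner ℝ (y₁ x) (y₂ x) ≤ ‖y₁ x‖ * (C * (‖y₁ x‖ + ‖y x‖ / x)) :=
      (real_inner_le_norm _ _).trans (by gcongr; exact hbound x hx)
    have i2 : inner ℝ (y x) (y₁ x) / x ≤ ‖y x‖ / x * ‖y₁ x‖ := by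
      rw [div_mul_eq_mul_div]
      gcongr
      exact real_inner_le_norm _ _
    have i3 : (2 * inner ℝ (y x) (y₁ x) * x - ‖y x‖ ^ 2 * 1) / x ^ 2
        = 2 * (inner ℝ (y x) (y₁ x) / x) - (‖y x‖ / x) ^ 2 := by
      field_simp
    have i4 : ‖y₁ x‖ ^ 2 ≤ E x := by
      have : 0 ≤ ‖y x‖ ^ 2 / x := by positivity
      simp only [hE]; linarith
    have hK0 : 0 ≤ K := by positivity
    have i5 : K * ‖y₁ x‖ ^ 2 ≤ K * E x := by gcongr
    rw [i3]
    set p := ‖y₁ x‖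
    set q := ‖y x‖ / x
    have i6 : 2 * inner ℝ (y₁ x) (y₂ x) + (2 * (inner ℝ (y x) (y₁ x) / x) - q ^ 2)
        ≤ K * p ^ 2 := by
      nlinarith [sq_nonneg ((C + 1) * p - q)]
    have i7 := Real.exp_pos (-K * x)
    nlinarith
  have hanti : AntitoneOn F (Set.Ioc 0 r) := by
    refine antitoneOn_of_deriv_nonpos (convex_Ioc 0 r) ?_ ?_ ?_
    · intro x hx
      obtain ⟨d, _, hd⟩ := hFd x hx
      exact hd.continuousAt.continuousWithinAt
    · intro x hx
      obtain ⟨d, _, hd⟩ := hFd x (interior_subset hx)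
      exact hd.differentiableAt.differentiableWithinAt
    · intro x hx
      obtain ⟨d, hd0, hd⟩ := hFd x (interior_subset hx)
      rwa [hd.deriv]
  have hlim : Filter.Tendsto F (nhdsWithin 0 (Set.Ioi 0)) (nhds 0) := by
    have l1 : Filter.Tendsto (fun x : ℝ => Real.exp (-K * x)) (nhdsWithin 0 (Set.Ioi 0))
        (nhds (Real.exp (-K * 0))) :=
      (Continuous.tendsto (by fun_prop) 0).mono_left nhdsWithin_le_nhds
    simpa [hF, hE] using l1.mul (h1.add h0)
  have hFr : F r ≤ 0 := by
    refine ge_of_tendsto hlim ?_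
    filter_upwards [Ioc_mem_nhdsGT hr.1] with x hx
    exact hanti hx ⟨hr.1, le_rfl⟩ hx.2
  have hEr : E r ≤ 0 := by
    by_contra! h
    exact absurd hFr (not_le.2 (mul_pos (Real.exp_pos _) h))
  have hy0 : ‖y r‖ ^ 2 / r ≤ 0 := by
    have := sq_nonneg ‖y₁ r‖
    simp only [hE] at hEr
    linarith
  have : ‖y r‖ ^ 2 ≤ 0 := by
    have := (div_le_iff₀ hr.1).1 hy0
    linarith
  exact norm_eq_zero.1 (pow_eq_zero_iff two_ne_zero |>.1 (le_antisymm this (sq_nonneg _)))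

/-- `u` is arbitrary outside `[0,1]`, so `deriv u` says nothing at the endpoints. The derivative
within `[0,1]` is continuous up to them and agrees with `deriv u` inside. -/
theorem IsSLEigenvalue.exists_solvesAt {ε : ℝ} {m : ℂ} (h : IsSLEigenvalue ε m) :
    ∃ u u₁ u₂ : ℝ → ℂ, ContinuousOn u (Set.Icc 0 1) ∧ ContinuousOn u₁ (Set.Icc 0 1) ∧
      HasDerivWithinAt u (u₁ 0) (Set.Icc 0 1) 0 ∧ u 0 = 0 ∧
      (∃ x ∈ Set.Ioo (0 : ℝ) 1, u x ≠ 0) ∧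
      ∀ x ∈ Set.Ioo (0 : ℝ) 1, SolvesAt ε m u u₁ u₂ x := by
  obtain ⟨u, hu, hu0, ⟨x₀, hx₀, hux₀⟩, heq⟩ := h
  have hud : UniqueDiffOn ℝ (Set.Icc (0 : ℝ) 1) := uniqueDiffOn_Icc zero_lt_one
  have hu1 : ContDiffOn ℝ ∞ (derivWithin u (Set.Icc 0 1)) (Set.Icc 0 1) :=
    hu.derivWithin hud (by simp)
  have hd : ∀ x ∈ Set.Ioo (0 : ℝ) 1, HasDerivAt u (derivWithin u (Set.Icc 0 1) x) x :=
    fun x hx => ((hu.differentiableOn (by simp)) x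
      (Set.Ioo_subset_Icc_self hx)).hasDerivWithinAt.hasDerivAt (Icc_mem_nhds hx.1 hx.2)
  refine ⟨u, derivWithin u (Set.Icc 0 1), deriv (derivWithin u (Set.Icc 0 1)), hu.continuousOn,
    hu1.continuousOn, ((hu.differentiableOn (by simp)) 0 (by simp)).hasDerivWithinAt, hu0, ?_, ?_⟩
  · by_contra! hz
    have hcl : Set.EqOn u 0 (Set.Icc 0 1) := by
      have : closure (Set.Ioo (0 : ℝ) 1) = Set.Icc 0 1 := closure_Ioo zero_ne_one
      refine Set.EqOn.of_subset_closure (s := Set.Ioo 0 1) hz hu.continuousOn continuousOn_const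
        Set.Ioo_subset_Icc_self this.ge
    exact hux₀ (hcl hx₀)
  · intro x hx
    refine SolvesAt.of_flux hx (hd x hx) ?_ ?_
    · exact (((hu1.differentiableOn (by simp)) x
        (Set.Ioo_subset_Icc_self hx)).differentiableAt (Icc_mem_nhds hx.1 hx.2)).hasDerivAt
    · rw [← heq x hx]
      congr 1
      refine Filter.EventuallyEq.deriv_eq ?_
      filter_upwards [Ioo_mem_nhds hx.1 hx.2] with y hy
      rw [(hd y hy).deriv]

theorem continuousOn_slP {ε : ℝ} (hε : 0 < ε) : ContinuousOn (slP ε) (Set.Icc 0 1) := by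
  refine ContinuousOn.mul ?_ ?_
  · exact ContinuousOn.rpow_const (by fun_prop) fun x _ => Or.inr (by positivity)
  · exact ContinuousOn.rpow_const (by fun_prop) fun x hx => Or.inl (by linarith [hx.1])

theorem slP_one {ε : ℝ} (hε : 0 < ε) : slP ε 1 = 0 := by
  have : (1 : ℝ) + 1 / ε ≠ 0 := by positivity
  rw [slP, sub_self, Real.zero_rpow this, zero_mul]

/-- Eigenvalues of the Sturm–Liouville problem are real. -/
theorem im_eq_zero_of_solvesAt {ε : ℝ} (hε : 0 < ε) {m : ℂ} {u u₁ u₂ : ℝ → ℂ}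
    (hu : ContinuousOn u (Set.Icc 0 1)) (hu₁ : ContinuousOn u₁ (Set.Icc 0 1)) (h0 : u 0 = 0)
    (hne : ∃ x ∈ Set.Ioo (0 : ℝ) 1, u x ≠ 0)
    (hsol : ∀ x ∈ Set.Ioo (0 : ℝ) 1, SolvesAt ε m u u₁ u₂ x) : m.im = 0 := by
  -- The factor `m.im` makes `J` antitone whatever the sign of `m.im`. As `u(0) = 0` and `p(1) = 0`,
  -- `J` vanishes at both ends, hence throughout. No integral of the singular weight is needed.
  set J : ℝ → ℝ := fun x => m.im * ((starRingEnd ℂ) (u x) * ((slP ε x : ℂ) * u₁ x)).im with hJ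
  have hd : ∀ x ∈ Set.Ioo (0 : ℝ) 1,
      HasDerivAt J (-(m.im ^ 2 * slW ε x * ‖u x‖ ^ 2)) x := by
    intro x hx
    have s := hsol x hx
    have d := (s.hasDerivAt.star.mul (s.hasDerivAt_flux hx))
    have d' := ((Complex.imCLM.hasFDerivAt.comp_hasDerivAt x d).const_mul m.im)
    refine d'.congr_deriv ?_
    have e1 : ‖u x‖ ^ 2 = (u x).re * (u x).re + (u x).im * (u x).im := by
      rw [← Complex.normSq_eq_norm_sq, Complex.normSq_apply]
    rw [e1]
    simp
    ring
  have hcont : ContinuousOn J (Set.Icc 0 1) := by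
    refine continuousOn_const.mul (Complex.continuous_im.comp_continuousOn ?_)
    exact (Complex.continuous_conj.comp_continuousOn hu).mul
      ((Complex.continuous_ofReal.comp_continuousOn (continuousOn_slP hε)).mul hu₁)
  have hanti : AntitoneOn J (Set.Icc 0 1) := by
    refine antitoneOn_of_deriv_nonpos (convex_Icc 0 1) hcont ?_ ?_
    · rw [interior_Icc]
      exact fun x hx => (hd x hx).differentiableAt.differentiableWithinAt
    · rw [interior_Icc]
      intro x hx
      have := (slW_pos (ε := ε) hx).le
      rw [(hd x hx).deriv, neg_nonpos]
      positivity
  have hJ0 : J 0 = 0 := by simp [hJ, h0]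
  have hJ1 : J 1 = 0 := by simp [hJ, slP_one hε]
  have hzero : ∀ x ∈ Set.Icc (0 : ℝ) 1, J x = 0 := fun x hx =>
    le_antisymm ((hanti (by simp) hx hx.1).trans_eq hJ0)
      (hJ1.symm.trans_le (hanti hx (by simp) hx.2))
  obtain ⟨x, hx, hux⟩ := hne
  have hev : J =ᶠ[nhds x] fun _ => 0 := by
    filter_upwards [Icc_mem_nhds hx.1 hx.2] with y hy using hzero y hy
  have hz := (hd x hx).deriv
  rw [hev.deriv_eq, deriv_const] at hz
  have hw := slW_pos (ε := ε) hx
  have hn : 0 < ‖u x‖ ^ 2 := by positivity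
  by_contra hm
  have : 0 < m.im ^ 2 := by positivity
  have : 0 < m.im ^ 2 * slW ε x * ‖u x‖ ^ 2 := by positivity
  linarith

/-! ### The dichotomy for the recurrence and its effect on power series. -/

/-- A real sequence with `b (n + 2) = b n + κ n * b (n + 1)`, `κ n ≥ 0` for large `n`, is either
bounded (alternating signs) or eventually of one sign and bounded away from zero. -/
theorem bounded_or_eventually_ge {b κ : ℕ → ℝ} {N : ℕ} (hκ : ∀ n ≥ N, 0 ≤ κ n)
    (hb : ∀ n ≥ N, b (n + 2) = b n + κ n * b (n + 1)) :
    (∃ C, ∀ n, |b n| ≤ C) ∨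
      ∃ δ > 0, ∃ M, ∃ σ : ℝ, |σ| = 1 ∧ ∀ n ≥ M, δ ≤ σ * b n := by
  -- One neighbouring pair of equal strict sign propagates: all later terms keep the sign and stay
  -- above the smaller modulus.
  by_cases hA : ∃ n ≥ N, 0 < b n * b (n + 1)
  · right
    obtain ⟨M, hM, hpos⟩ := hA
    obtain ⟨σ, hσ, h1, h2⟩ : ∃ σ : ℝ, |σ| = 1 ∧ 0 < σ * b M ∧ 0 < σ * b (M + 1) := by
      rcases pos_and_pos_or_neg_and_neg_of_mul_pos hpos with ⟨h1, h2⟩ | ⟨h1, h2⟩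
      · exact ⟨1, by simp, by linarith, by linarith⟩
      · exact ⟨-1, by simp, by linarith, by linarith⟩
    set δ := min (σ * b M) (σ * b (M + 1)) with hδ
    have hδ0 : 0 < δ := lt_min h1 h2
    have key : ∀ k, δ ≤ σ * b (M + k) ∧ δ ≤ σ * b (M + k + 1) := by
      intro k
      induction k with
      | zero => exact ⟨min_le_left _ _, min_le_right _ _⟩
      | succ k ih =>
        refine ⟨ih.2, ?_⟩
        have e := hb (M + k) (by omega)
        have hk := hκ (M + k) (by omega)
        have : σ * b (M + (k + 1) + 1) = σ * b (M + k) + κ (M + k) * (σ * b (M + k + 1)) := by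
          rw [show M + (k + 1) + 1 = M + k + 2 by ring, e]; ring
        rw [this]
        nlinarith [ih.1, ih.2]
    refine ⟨δ, hδ0, M, σ, hσ, fun n hn => ?_⟩
    obtain ⟨k, rfl⟩ := Nat.exists_eq_add_of_le hn
    exact (key k).1
  · left
    push Not at hA
    -- Here `κ n * b (n+1)` opposes `b n` without reversing its sign, so the modulus cannot grow.
    have hstep : ∀ n ≥ N, |b (n + 2)| ≤ |b n| := by
      intro n hn
      have e := hb n hn
      have hk := hκ n hn
      have p1 := hA n hn
      have p2 := hA (n + 1) (by omega)
      rw [show n + 1 + 1 = n + 2 by ring] at p2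
      rcases lt_trichotomy (b (n + 1)) 0 with h | h | h
      · have q1 : 0 ≤ b n := by nlinarith
        have q2 : 0 ≤ b (n + 2) := by nlinarith
        rw [abs_of_nonneg q1, abs_of_nonneg q2]
        nlinarith
      · rw [e, h, mul_zero, add_zero]
      · have q1 : b n ≤ 0 := by nlinarith
        have q2 : b (n + 2) ≤ 0 := by nlinarith
        rw [abs_of_nonpos q1, abs_of_nonpos q2]
        nlinarith
    have key : ∀ k, |b (N + k)| ≤ max |b N| |b (N + 1)| ∧
        |b (N + k + 1)| ≤ max |b N| |b (N + 1)| := by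
      intro k
      induction k with
      | zero => exact ⟨le_max_left _ _, le_max_right _ _⟩
      | succ k ih => exact ⟨ih.2, (hstep (N + k) (by omega)).trans ih.1⟩
    refine ⟨∑ i ∈ Finset.range N, |b i| + max |b N| |b (N + 1)|, fun n => ?_⟩
    have hs : 0 ≤ ∑ i ∈ Finset.range N, |b i| := Finset.sum_nonneg fun i _ => abs_nonneg _
    have hm : 0 ≤ max |b N| |b (N + 1)| := le_max_of_le_left (abs_nonneg _)
    rcases lt_or_ge n N with hn | hn
    · have := Finset.single_le_sum (f := fun i => |b i|) (fun i _ => abs_nonneg _)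
        (Finset.mem_range.2 hn)
      linarith
    · obtain ⟨k, rfl⟩ := Nat.exists_eq_add_of_le hn
      linarith [(key k).1]

/-- A power series whose real coefficients are eventually of one sign and bounded away from zero
is unbounded on `[0, 1)`. -/
theorem not_bounded_pser_of_eventually_ge {g : ℕ → ℝ} (hg : ConvOn 1 fun n => (g n : ℂ))
    {δ σ : ℝ} {M : ℕ} (hδ : 0 < δ) (hσ : |σ| = 1) (h : ∀ n ≥ M, δ ≤ σ * g n) (B : ℝ) :
    ¬ ∀ x ∈ Set.Ioo (0 : ℝ) 1, ‖pser (fun n => (g n : ℂ)) x‖ ≤ B := by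
  intro hB
  -- The omitted tail is nonnegative, so partial sums at `x` are at most `B`; then `x → 1` with `T`
  -- fixed.
  have hpart : ∀ T ≥ M, ∑ n ∈ Finset.range T, σ * g n ≤ B := by
    intro T hT
    have hx : ∀ x ∈ Set.Ioo (0 : ℝ) 1, ∑ n ∈ Finset.range T, σ * g n * x ^ n ≤ B := by
      intro x hx
      have s := hg.hasSum (x := x) (by rw [abs_of_pos hx.1]; exact hx.2)
      have s' : HasSum (fun n => σ * g n * x ^ n) (σ * (pser (fun n => (g n : ℂ)) x).re) := by
        have := (Complex.hasSum_re s).mul_left σ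
        refine this.congr_fun fun n => ?_
        rw [← Complex.ofReal_pow, ← Complex.ofReal_mul, Complex.ofReal_re]
        ring
      refine (sum_le_hasSum _ (fun n hn => ?_) s').trans ?_
      · have : M ≤ n := hT.le.trans (by simpa using hn)
        exact mul_nonneg (hδ.le.trans (h n this)) (pow_nonneg hx.1.le n)
      · refine le_trans ?_ (hB x hx)
        refine (le_abs_self _).trans ?_
        rw [abs_mul, hσ, one_mul]
        exact Complex.abs_re_le_norm _
    have hlim : Filter.Tendsto (fun x : ℝ => ∑ n ∈ Finset.range T, σ * g n * x ^ n)
        (nhdsWithin 1 (Set.Iio 1)) (nhds (∑ n ∈ Finset.range T, σ * g n * 1 ^ n)) :=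
      (Continuous.tendsto (by fun_prop) 1).mono_left nhdsWithin_le_nhds
    simp only [one_pow, mul_one] at hlim
    refine le_of_tendsto hlim ?_
    filter_upwards [Ioo_mem_nhdsLT one_pos] with x hx' using hx x hx'
  have hlow : ∀ k : ℕ, ∑ n ∈ Finset.range M, σ * g n + k * δ
      ≤ ∑ n ∈ Finset.range (M + k), σ * g n := by
    intro k
    induction k with
    | zero => simp
    | succ k ih =>
      rw [← add_assoc, Finset.sum_range_succ]
      have := h (M + k) (by omega)
      push_cast
      linarith
  obtain ⟨k, hk⟩ := exists_nat_gt ((B - ∑ n ∈ Finset.range M, σ * g n) / δ)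
  rw [div_lt_iff₀ hδ] at hk
  linarith [hlow k, hpart (M + k) (by omega)]

/-! ### The formal eigenvector and its square-summability. -/

/-- The normalised formal eigenvector. -/
noncomputable def eigCoeff (ε m : ℝ) : ℕ → ℝ
  | 0 => 0
  | 1 => 1
  | n + 2 => (((n : ℝ) + 1) * n * eigCoeff ε m n + (2 / ε * (n + 1) - m) * eigCoeff ε m (n + 1)) /
      (((n : ℝ) + 1) * (n + 2))

theorem eigCoeff_rec (ε m : ℝ) (n : ℕ) :
    ((n : ℝ) + 1) * (n + 2) * eigCoeff ε m (n + 2) =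
      (n + 1) * n * eigCoeff ε m n + (2 / ε * (n + 1) - m) * eigCoeff ε m (n + 1) := by
  rw [eigCoeff, mul_div_cancel₀]
  positivity

/-- In terms of `n * eigCoeff ε m n`, the coefficients of the derivative, the older term gets weight
exactly `1`, as the dichotomy requires. -/
theorem natCast_mul_eigCoeff_rec (ε m : ℝ) (n : ℕ) :
    ((n + 2 : ℕ) : ℝ) * eigCoeff ε m (n + 2) = n * eigCoeff ε m n +
      (2 / ε - m / (n + 1)) / (n + 1) * (((n + 1 : ℕ) : ℝ) * eigCoeff ε m (n + 1)) := by
  have h := eigCoeff_rec ε m n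
  have hn : (n : ℝ) + 1 ≠ 0 := by positivity
  refine mul_left_cancel₀ hn ?_
  push_cast
  field_simp
  linear_combination h

/-- One step multiplies the bound by at most `1 + 2K/(n+2)`, which Bernoulli's inequality bounds by
`((n+3)/(n+2))^(2K)`. -/
theorem natCast_mul_eigCoeff_abs_le {ε : ℝ} (hε : 0 < ε) (m : ℝ) {K : ℕ} (hK : 2 / ε + |m| ≤ K)
    (n : ℕ) :
    |n * eigCoeff ε m n| ≤ ((n : ℝ) + 1) ^ (2 * K) ∧
      |((n + 1 : ℕ) : ℝ) * eigCoeff ε m (n + 1)| ≤ ((n : ℝ) + 2) ^ (2 * K) := by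
  induction n with
  | zero => simpa [eigCoeff] using one_le_pow₀ (one_le_two : (1 : ℝ) ≤ 2)
  | succ n ih =>
    refine ⟨by convert ih.2 using 2; push_cast; ring, ?_⟩
    have hn : (0 : ℝ) < (n : ℝ) + 1 := by positivity
    have hκ : |(2 / ε - m / (n + 1)) / (n + 1)| ≤ 2 * K / ((n : ℝ) + 2) := by
      have h1 : |2 / ε - m / (n + 1)| ≤ K := by
        refine (abs_sub _ _).trans ?_
        rw [abs_div, abs_div, abs_of_pos hε, abs_of_pos hn, abs_two]
        have : |m| / ((n : ℝ) + 1) ≤ |m| := div_le_self (abs_nonneg _) (by linarith)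
        linarith
      rw [abs_div, abs_of_pos hn, div_le_div_iff₀ hn (by positivity)]
      have hKn : (0 : ℝ) ≤ K := K.cast_nonneg
      nlinarith [(n.cast_nonneg : (0 : ℝ) ≤ n)]
    have hbern : 1 + ((2 * K : ℕ) : ℝ) * (1 / ((n : ℝ) + 2)) ≤ (1 + 1 / ((n : ℝ) + 2)) ^ (2 * K) :=
      one_add_mul_le_pow (by
        have : (0 : ℝ) ≤ 1 / ((n : ℝ) + 2) := by positivity
        linarith) _
    rw [show n + 1 + 1 = n + 2 by ring, natCast_mul_eigCoeff_rec]
    calc _ ≤ |n * eigCoeff ε m n| + |(2 / ε - m / (n + 1)) / (n + 1)| *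
            |((n + 1 : ℕ) : ℝ) * eigCoeff ε m (n + 1)| := by
          rw [← abs_mul]; exact abs_add_le _ _
      _ ≤ ((n : ℝ) + 2) ^ (2 * K) + 2 * K / ((n : ℝ) + 2) * ((n : ℝ) + 2) ^ (2 * K) := by
          gcongr
          · refine ih.1.trans ?_
            gcongr
            norm_num
          · exact ih.2
      _ = ((n : ℝ) + 2) ^ (2 * K) * (1 + ((2 * K : ℕ) : ℝ) * (1 / ((n : ℝ) + 2))) := by
          push_cast; ring
      _ ≤ ((n : ℝ) + 2) ^ (2 * K) * (1 + 1 / ((n : ℝ) + 2)) ^ (2 * K) := by gcongr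
      _ = (((n + 1 : ℕ) : ℝ) + 2) ^ (2 * K) := by
          rw [← mul_pow]; congr 1; push_cast; field_simp; ring

theorem eigCoeff_abs_le (ε m : ℝ) (n : ℕ) : |eigCoeff ε m n| ≤ |n * eigCoeff ε m n| := by
  cases n with
  | zero => simp [eigCoeff]
  | succ n =>
    rw [abs_mul]
    refine le_mul_of_one_le_left (abs_nonneg _) ?_
    rw [Nat.abs_cast]
    exact_mod_cast Nat.succ_le_succ n.zero_le

theorem convOn_eigCoeff {ε : ℝ} (hε : 0 < ε) (m : ℝ) :
    ConvOn 1 fun n => (eigCoeff ε m n : ℂ) := by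
  obtain ⟨K, hK⟩ := exists_nat_ge (2 / ε + |m|)
  refine ConvOn.of_norm_le_polynomial (C := 1) (2 * K) fun n => ?_
  rw [Complex.norm_real, Real.norm_eq_abs, one_mul]
  exact (eigCoeff_abs_le ε m n).trans (natCast_mul_eigCoeff_abs_le hε m hK n).1

theorem summable_sq_eigCoeff {ε m C : ℝ} (h : ∀ n : ℕ, |n * eigCoeff ε m n| ≤ C) :
    Summable fun n => ‖(eigCoeff ε m n : ℂ)‖ ^ 2 := by
  have hs : Summable fun n : ℕ => C ^ 2 * (1 / (n : ℝ) ^ 2) :=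
    (Real.summable_one_div_nat_pow.2 one_lt_two).mul_left _
  refine hs.of_nonneg_of_le (fun n => by positivity) fun n => ?_
  rw [Complex.norm_real, Real.norm_eq_abs]
  cases n with
  | zero => simp [eigCoeff]
  | succ n =>
    have h1 := h (n + 1)
    rw [abs_mul, Nat.abs_cast] at h1
    rw [mul_one_div, le_div_iff₀ (by positivity), ← mul_pow]
    gcongr
    linarith

/-- At an eigenvalue of the Sturm–Liouville problem the formal eigenvector is square-summable. -/
theorem IsSLEigenvalue.summable_sq {ε : ℝ} (hε : 0 < ε) {m : ℂ} (h : IsSLEigenvalue ε m) :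
    m.im = 0 ∧ Summable fun n => ‖(eigCoeff ε m.re n : ℂ)‖ ^ 2 := by
  obtain ⟨u, u₁, u₂, hu, hu₁, hd0, h0, hne, hsol⟩ := h.exists_solvesAt
  have him := im_eq_zero_of_solvesAt hε hu hu₁ h0 hne hsol
  refine ⟨him, ?_⟩
  have hm : ((m.re : ℝ) : ℂ) = m := Complex.ext (by simp) (by simp [him])
  set b : ℕ → ℝ := fun n => n * eigCoeff ε m.re n with hb
  set a : ℕ → ℂ := fun n => (eigCoeff ε m.re n : ℂ) with ha
  have hconv : ConvOn 1 a := convOn_eigCoeff hε m.re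
  have hda : dcoeff a = fun n => ((b (n + 1) : ℝ) : ℂ) := by
    funext n
    simp [dcoeff, ha, hb]
  have hsolf : ∀ x ∈ Set.Ioo (0 : ℝ) 1,
      SolvesAt ε m (pser a) (pser (dcoeff a)) (pser (dcoeff (dcoeff a))) x := by
    intro x hx
    refine solvesAt_pser hconv (by simp [ha, eigCoeff]) (fun n => ?_)
      (by rw [abs_of_pos hx.1]; exact hx.2)
    have e := congrArg (fun t : ℝ => (t : ℂ)) (eigCoeff_rec ε m.re n)
    rw [← hm]
    simpa using e
  set c := u₁ 0 with hc
  have hnhds : nhdsWithin (0 : ℝ) (Set.Ioi 0) ≤ nhdsWithin 0 (Set.Icc 0 1) := by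
    rw [← nhdsWithin_Ioc_eq_nhdsGT (zero_lt_one (α := ℝ))]
    exact nhdsWithin_mono _ Set.Ioc_subset_Icc_self
  have hf0 : |(0 : ℝ)| < 1 := by simp
  have hfd := pser_hasDerivAt hconv hf0
  have hfc := (pser_hasDerivAt hconv.dcoeff hf0).continuousAt
  have hda0 : pser (dcoeff a) 0 = 1 := by simp [pser_zero, dcoeff, ha, eigCoeff]
  -- Subtracting `c = u'(0)` times the series, whose derivative at `0` is `1`, removes both value
  -- and derivative there. The second limit is `|y|²/x = |y/x| |y|`.
  have hzero := eq_zero_of_solvesAt hε (fun x hx => (hsol x hx).sub_smul (c := c) (hsolf x hx))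
    (by
      have l1 := (hu₁ 0 (by simp)).tendsto.mono_left hnhds
      have l2 := (hfc.tendsto.mono_left (nhdsWithin_le_nhds (s := Set.Ioi 0))).const_mul c
      rw [hda0, mul_one] at l2
      have := ((l1.sub l2).norm).pow 2
      simpa [hc] using this)
    (by
      have hy := (hd0.mono_of_mem_nhdsWithin (hnhds self_mem_nhdsWithin)).sub
        ((hfd.hasDerivWithinAt (s := Set.Ioi 0)).const_mul c)
      rw [hda0, mul_one, sub_self, hasDerivWithinAt_iff_tendsto_slope' (by simp)] at hy
      have hcont : Filter.Tendsto (fun x => u x - c * pser a x) (nhdsWithin 0 (Set.Ioi 0))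
          (nhds 0) := by
        have l1 := (hu 0 (by simp)).tendsto.mono_left hnhds
        have l2 := (hfd.continuousAt.tendsto.mono_left
          (nhdsWithin_le_nhds (s := Set.Ioi 0))).const_mul c
        have := l1.sub l2
        simpa [h0, pser_zero, ha, eigCoeff] using this
      have := hy.norm.mul hcont.norm
      rw [norm_zero, mul_zero] at this
      refine this.congr' ?_
      filter_upwards [self_mem_nhdsWithin] with x hx
      have hx0 : 0 < x := hx
      simp only [slope, vsub_eq_sub, Pi.sub_apply, sub_zero, h0, pser_zero, norm_smul, norm_inv,
        Real.norm_of_nonneg hx0.le]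
      simp [ha, eigCoeff]
      field_simp)
  have hc0 : c ≠ 0 := by
    intro hc0
    obtain ⟨x, hx, hux⟩ := hne
    have := hzero x hx
    rw [hc0, zero_mul, sub_zero] at this
    exact hux this
  have hderiv : ∀ x ∈ Set.Ioo (0 : ℝ) 1, u₁ x = c * pser (dcoeff a) x := by
    intro x hx
    have hev : (fun t => u t - c * pser a t) =ᶠ[nhds x] fun _ => 0 := by
      filter_upwards [Ioo_mem_nhds hx.1 hx.2] with y hy using hzero y hy
    have d := ((hsol x hx).sub_smul (c := c) (hsolf x hx)).hasDerivAt
    have := d.unique ((hasDerivAt_const x (0 : ℂ)).congr_of_eventuallyEq hev)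
    exact sub_eq_zero.1 this
  obtain ⟨B, hB⟩ := isCompact_Icc.exists_bound_of_continuousOn hu₁
  have hbdd : ∀ x ∈ Set.Ioo (0 : ℝ) 1, ‖pser (dcoeff a) x‖ ≤ B / ‖c‖ := by
    intro x hx
    rw [le_div_iff₀ (norm_pos_iff.2 hc0), mul_comm, ← norm_mul, ← hderiv x hx]
    exact hB x (Set.Ioo_subset_Icc_self hx)
  -- Beyond this index `m.re/(n+1) ≤ 2/ε`, so `κ` is nonnegative.
  obtain ⟨N, hN⟩ := exists_nat_ge (|m.re| * ε)
  have hκ : ∀ n ≥ N, 0 ≤ (2 / ε - m.re / ((n : ℝ) + 1)) / ((n : ℝ) + 1) := by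
    intro n hn
    have hn' : (N : ℝ) ≤ n := by exact_mod_cast hn
    have h1 : m.re / ((n : ℝ) + 1) ≤ 2 / ε := by
      rw [div_le_div_iff₀ (by positivity) hε]
      have := mul_le_mul_of_nonneg_right (le_abs_self m.re) hε.le
      linarith [(n.cast_nonneg : (0 : ℝ) ≤ n)]
    exact div_nonneg (by linarith) (by positivity)
  rcases bounded_or_eventually_ge (b := b) hκ
    (fun n _ => natCast_mul_eigCoeff_rec ε m.re n) with ⟨C, hC⟩ | ⟨δ, hδ, M, σ, hσ, hge⟩
  · exact summable_sq_eigCoeff hC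
  · refine absurd hbdd ?_
    have hc1 := hconv.dcoeff
    rw [hda] at hc1 ⊢
    exact not_bounded_pser_of_eventually_ge (M := M) hc1 hδ hσ (fun n hn => hge (n + 1) (by omega)) _

/-! ### Eigenvectors of `A₊` as solutions of the recurrence. -/

theorem formalAPlus_eq_smul_iff {ε : ℝ} (hε : 0 < ε) {z : ℂ} {a : ℕ → ℂ} :
    formalAPlus ε (fun n : ℕ+ => a n) = z • (fun n : ℕ+ => a n) ↔
      ∀ n : ℕ, ((n : ℂ) + 1) * (n + 2) * a (n + 2) =
        (n + 1) * n * a n + (2 / (ε : ℂ) * (n + 1) - 2 * z / (ε : ℂ)) * a (n + 1) := by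
  have hε' : (ε : ℂ) ≠ 0 := by exact_mod_cast hε.ne'
  have key (n : ℕ) : formalAPlus ε (fun n : ℕ+ => a n) n.succPNat =
      (ε : ℂ) / 2 * (((n : ℂ) + 1) * n) * a n
        - (ε : ℂ) / 2 * (((n : ℂ) + 1) * (n + 2)) * a (n + 2) + ((n : ℂ) + 1) * a (n + 1) := by
    -- For `n = 0` the `ℕ+` subtraction returns `1` instead of `0`; the factor `n` hides the
    -- discrepancy.
    have e1 : a ((n.succPNat - 1 : ℕ+) : ℕ) * n = a n * n := by
      cases n with
      | zero => simp
      | succ n =>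
        have : (((n + 1).succPNat - 1 : ℕ+) : ℕ) = n + 1 := by
          rw [PNat.sub_coe, if_pos]
          · simp
          · exact PNat.coe_lt_coe _ _ |>.1 (by simp)
        rw [this]
    have e2 : ((n.succPNat + 1 : ℕ+) : ℕ) = n + 2 := by simp
    change (ε : ℂ) / 2 * (((n.succPNat : ℕ) : ℂ) * (((n.succPNat : ℕ) : ℂ) - 1)) *
      a ((n.succPNat - 1 : ℕ+) : ℕ) - (ε : ℂ) / 2 * (((n.succPNat : ℕ) : ℂ) *
      (((n.succPNat : ℕ) : ℂ) + 1)) * a ((n.succPNat + 1 : ℕ+) : ℕ) +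
      ((n.succPNat : ℕ) : ℂ) * a (n.succPNat : ℕ) = _
    rw [e2, Nat.succPNat_coe]
    push_cast
    linear_combination (ε : ℂ) / 2 * ((n : ℂ) + 1) * e1
  constructor
  · intro h n
    have := congrFun h n.succPNat
    rw [key] at this
    simp only [Pi.smul_apply, Nat.succPNat_coe, smul_eq_mul, Nat.succ_eq_add_one] at this
    field_simp
    linear_combination -2 * this
  · intro h
    funext k
    obtain ⟨n, rfl⟩ : ∃ n : ℕ, n.succPNat = k := ⟨k.natPred, PNat.succPNat_natPred k⟩
    rw [key]
    simp only [Pi.smul_apply, Nat.succPNat_coe, smul_eq_mul, Nat.succ_eq_add_one]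
    have := h n
    field_simp at this ⊢
    linear_combination -this

theorem memℓp_two_iff {v : ℕ+ → ℂ} : Memℓp v 2 ↔ Summable fun n => ‖v n‖ ^ 2 := by
  rw [memℓp_gen_iff (by norm_num)]
  simp

/-- The recurrence determines everything from `a 0 = 0` and `a 1`, so a nonzero vector has `a 1 ≠
0`. Membership in the maximal domain is automatic, because the image is `z` times an `ℓ²` vector. -/
theorem isEigenvalue_APlus_iff {ε : ℝ} (hε : 0 < ε) {z : ℂ} :
    IsEigenvalue (APlus ε) z ↔ ∃ a : ℕ → ℂ, a 0 = 0 ∧ a 1 ≠ 0 ∧ (Summable fun n => ‖a n‖ ^ 2) ∧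
      ∀ n : ℕ, ((n : ℂ) + 1) * (n + 2) * a (n + 2) =
        (n + 1) * n * a n + (2 / (ε : ℂ) * (n + 1) - 2 * z / (ε : ℂ)) * a (n + 1) := by
  constructor
  · rintro ⟨v, hv, heq⟩
    set w : ℕ+ → ℂ := ((v : EllTwo) : ℕ+ → ℂ) with hw
    set a : ℕ → ℂ := fun n => if h : 0 < n then w ⟨n, h⟩ else 0 with ha
    have haw : (fun n : ℕ+ => a n) = w := by
      funext n
      exact dif_pos n.pos
    have h0 : a 0 = 0 := by simp [ha]
    have hform : formalAPlus ε w = z • w := congrArg (fun t : EllTwo => (t : ℕ+ → ℂ)) heq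
    rw [← haw, formalAPlus_eq_smul_iff hε] at hform
    refine ⟨a, h0, fun h1 => hv ?_, ?_, hform⟩
    · have hz : ∀ n, a n = 0 ∧ a (n + 1) = 0 := by
        intro n
        induction n with
        | zero => exact ⟨h0, h1⟩
        | succ n ih =>
          refine ⟨ih.2, ?_⟩
          have := hform n
          rw [ih.1, ih.2, mul_zero, mul_zero, add_zero] at this
          refine (mul_eq_zero.1 this).resolve_left ?_
          exact mul_ne_zero (by exact_mod_cast n.succ_ne_zero)
            (by exact_mod_cast (n + 1).succ_ne_zero)
      refine lp.ext ?_
      rw [← hw, ← haw]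
      funext n
      simpa using (hz n).1
    · have hs : Summable fun n : ℕ+ => ‖w n‖ ^ 2 := memℓp_two_iff.1 (lp.memℓp (v : EllTwo))
      rw [← summable_nat_add_iff 1]
      refine (hs.comp_injective Nat.succPNat_injective).congr fun n => ?_
      rw [← haw]
      simp
  · rintro ⟨a, h0, h1, hs, hrec⟩
    have hmem : Memℓp (fun n : ℕ+ => a n) 2 :=
      memℓp_two_iff.2 (hs.comp_injective PNat.coe_injective)
    have hform := (formalAPlus_eq_smul_iff hε).2 hrec
    refine ⟨⟨⟨fun n : ℕ+ => a n, hmem⟩, ?_⟩, fun h => h1 ?_, Subtype.ext hform⟩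
    · change Memℓp (formalAPlus ε (fun n : ℕ+ => a n)) 2
      rw [hform]
      exact hmem.const_smul z
    · exact congrFun (congrArg (fun t : EllTwo => (t : ℕ+ → ℂ)) h) 1

theorem isEigenvalue_APlus_iff_isSLEigenvalue {ε : ℝ} (hε : ε ∈ Set.Ioo (0 : ℝ) 2) (z : ℂ) :
    IsEigenvalue (APlus ε) z ↔ IsSLEigenvalue ε (2 * z / (ε : ℂ)) := by
  rw [isEigenvalue_APlus_iff hε.1]
  constructor
  · rintro ⟨a, h0, h1, hs, hrec⟩
    exact isSLEigenvalue_of_summable_sq hε hs h0 h1 hrec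
  · intro h
    obtain ⟨him, hs⟩ := h.summable_sq hε.1
    have hm : (((2 * z / (ε : ℂ)).re : ℝ) : ℂ) = 2 * z / (ε : ℂ) :=
      Complex.ext (by simp) (by rw [him, Complex.ofReal_im])
    refine ⟨fun n => (eigCoeff ε (2 * z / (ε : ℂ)).re n : ℂ), by simp [eigCoeff],
      by simp [eigCoeff], hs, fun n => ?_⟩
    have e := congrArg (fun t : ℝ => (t : ℂ)) (eigCoeff_rec ε (2 * z / (ε : ℂ)).re n)
    push_cast at e
    rw [hm] at e
    exact e

theorem mainTheorem2 (ε : ℝ) (hε : ε ∈ Set.Ioo (0 : ℝ) 2) :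
    (∀ μ : ℂ, IsSLEigenvalue ε μ → IsEigenvalue (APlus ε) ((ε : ℂ) * μ / 2)) ∧
    (∀ z : ℂ, IsEigenvalue (APlus ε) z ↔ IsSLEigenvalue ε (2 * z / (ε : ℂ))) := by
  refine ⟨fun μ hμ => ?_, isEigenvalue_APlus_iff_isSLEigenvalue hε⟩
  rw [isEigenvalue_APlus_iff_isSLEigenvalue hε]
  have hε' : (ε : ℂ) ≠ 0 := by exact_mod_cast hε.1.ne'
  convert hμ using 1
  field_simp
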